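/- **Setting.** Let $B\in\mathbb R^{m\times n}$, $b\in\mathbb R^m$, and let $\mathcal X=\{x\in\mathbb R^n: Bx\le b\}$ be compact, with (finite) vertex set $\mathcal U$. Let $M>0$, $\nu\in[2,3]$, and let $f:\mathbb R^n\to(-\infty,\infty]$ be a closed convex function with open domain $\operatorname{dom}f$, three times continuously differentiable on $\operatorname{dom} f$ and $(M,\nu)$-generalized self-concordant: $$|\langle D^3f(x)[v]u,u\rangle|\le M\,\|u\|_x^2\,\|v\|_x^{\nu-2}\,\|v\|_2^{3-\nu}\qquad(x\in\operatorname{dom}f,\ u,v\in\mathbb R^n),\qquad \|v\|_x=\langle\nabla^2f(x)v,v\rangle^{1/2}.$$ Assume that $\nabla^2 f$ is positive definite on $\mathcal X\cap\operatorname{dom}f$ and that $x^*$ minimizes $f$ over $\mathcal X$ with $f(x^*)<\infty$. Put $\omega_2(t)=\frac{e^t-t-1}{t^2}$, $\omega_3(t)=\frac{-t-\ln(1-t)}{t^2}$, and $\omega_\nu(t)=\frac{\nu-2}{4-\nu}\cdot\frac1t\Big[\frac{\nu-2}{2(3-\nu)t}\big((1-t)^{\frac{2(3-\nu)}{2-\nu}}-1\big)-1\Big]$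 for $2<\nu<3$, with $\omega_\nu(0)=\frac12$; for $\nu>2$ the function is considered for $t<1$ only. **Algorithm ASFWGSC.** Start at $x^0\in\mathcal U\cap\operatorname{dom} f$ with weights $\mu^0$ concentrated at $x^0$. At step $k$, $x^k=\sum_{u\in\mathcal U}\mu^k_u u$ with $\mu^k_u\ge 0$ and $\sum_u\mu^k_u=1$. Choose a vertex $s^k\in\mathcal U$ that minimizes $\langle\nabla f(x^k),\cdot\rangle$ over $\mathcal X$, and $u^k$ that maximizes $\langle\nabla f(x^k),\cdot\rangle$ over $\operatorname{supp}\mu^k$. If $\langle\nabla f(x^k),s^k-x^k\rangle\le\langle\nabla f(x^k),x^k-u^k\rangle$, set $v^k=s^k-x^k$ and $\bar t_k=1$ (forward step); otherwise set $v^k=x^k-u^k$ and $\bar t_k=\mu^k_{u^k}/(1-\mu^k_{u^k})$ (away step). Let $G_k=-\langle\nabla f(x^k),v^k\rangle$, $\beta_k=\|v^k\|_2$, $e_k=\|v^k\|_{x^k}$, and $\delta_k=\beta_k$ if $\nu=2$, $\delta_k=\frac{\nu-2}{2}\beta_k^{3-\nu}e_k^{\nu-2}$ if $\nu>2$. The step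 size $\alpha_k$ minimizes $$t\mapsto -tG_k+t^2e_k^2\,\omega_\nu(tM\delta_k)$$ over $t\in[0,\bar t_k]$ (with $tM\delta_k<1$ if $\nu>2$), or is given in closed form by $\alpha_k=\min\{\bar t_k,\mathtt t_k\}$, where $\mathtt t_k=0$ if $G_k=0$ and otherwise $$\mathtt t_k=\begin{cases}\frac1{M\delta_k}\ln\Big(1+\frac{G_kM\delta_k}{e_k^2}\Big)&\nu=2,\\[2pt] \frac1{M\delta_k}\Big[1-\Big(1+\frac{M\delta_kG_k}{e_k^2}\,\frac{4-\nu}{\nu-2}\Big)^{-\frac{\nu-2}{4-\nu}}\Big]&2<\nu<3,\\[2pt] \frac{G_k}{M\delta_kG_k+e_k^2}&\nu=3.\end{cases}$$ Set $x^{k+1}=x^k+\alpha_kv^k$. Update the weights to $(1-\alpha_k)\mu^k+\alpha_k\mathbf 1_{s^k}$ (forward) or $(1+\alpha_k)\mu^k-\alpha_k\mathbf 1_{u^k}$ (away), where $\mathbf 1_u$ is the unit mass at $u$. Then $\mu^{k+1}$ is either this vector or any other representation of $x^{k+1}$ as a convex combination of vertices from its support. **Constants.** Let $d=\operatorname{diam}\mathcal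 X$ and $\mathcal S(x^0)=\{x\in\mathcal X\cap\operatorname{dom}f: f(x)\le f(x^0)\}$, and let $L=\max_{x\in\mathcal S(x^0)}\lambda_{\max}(\nabla^2f(x))$, $\sigma_f=\min_{x\in\mathcal S(x^0)}\lambda_{\min}(\nabla^2f(x))$. Let $\tilde\gamma_\nu=1+\frac{4-\nu}{2(3-\nu)}\big(1-2^{2(3-\nu)/(4-\nu)}\big)$ for $2<\nu<3$, and $$c_1=\begin{cases}\min\{\frac12,\frac{2\ln2-1}{Md}\}&\nu=2,\\ \min\{\frac12,\frac{\tilde\gamma_\nu}{d(\nu/2-1)ML^{(\nu-2)/2}}\}&2<\nu<3,\\ \min\{\frac12,\frac{2(1-\ln2)}{M\sqrt L\,d}\}&\nu=3,\end{cases}\qquad c_2=\begin{cases}\frac{2\ln2-1}{Ld^2}&\nu=2,\\ \frac{4-\nu}{\nu-2}\cdot\frac{\tilde\gamma_\nu}{Ld^2}&2<\nu<3,\\ \frac{2(1-\ln2)}{Ld^2}&\nu=3.\end{cases}$$ Let $\zeta=\min\{b_i-(Bu)_i: u\in\mathcal U,\ (Bu)_i<b_i\}$, let $\varphi$ be the maximum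 of $\|B_i\|_2$ over all rows $i$ for which $(Bu)_i<b_i$ for some $u\in\mathcal U$, and put $\Omega_{\mathcal X}=\zeta/\varphi$, $\Omega=\Omega_{\mathcal X}/|\mathcal U|$ and $$\theta=\min\Big\{\frac12,\ \frac{c_1\Omega}{2d},\ \frac{c_2\,\Omega^2\sigma_f}{8}\Big\}.$$ **Theorem.** If $\mathcal X$ has more than one point, then $\theta>0$. For every $k\ge0$ we have $x^k\in\mathcal X\cap\operatorname{dom}f$, and with $h_k=f(x^k)-f(x^*)$, $$h_k\le(1-\theta)^{k/2}h_0\le\exp\big(-\theta k/2\big)\,h_0 .$$ (If $\mathcal X$ is a single point, then $h_k=0$ for all $k$ and the bound is trivial.) -/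

import Mathlib

open scoped Matrix

namespace ASFW

noncomputable section

/-! An extended-valued function with effective domain `D` is encoded by the set `D` together with
a real-valued function `f`, of which only the values on `D` matter (the value is `+∞` off `D`). -/

/-- The Hessian of `f` at `x`, the derivative of the gradient map. -/
def hessian {n : ℕ} (f : EuclideanSpace ℝ (Fin n) → ℝ) (x : EuclideanSpace ℝ (Fin n)) :
    EuclideanSpace ℝ (Fin n) →L[ℝ] EuclideanSpace ℝ (Fin n) :=
  fderiv ℝ (gradient f) x

/-- The local norm `‖v‖ₓ = ⟨∇²f(x) v, v⟩ ^ (1/2)`. -/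
def localNorm {n : ℕ} (f : EuclideanSpace ℝ (Fin n) → ℝ) (x v : EuclideanSpace ℝ (Fin n)) : ℝ :=
  Real.sqrt (inner ℝ (hessian f x v) v)

/-- `f`, with effective domain `D`, is `(M, ν)`-generalized self-concordant: `D` is open, `f` is
closed, convex and three times continuously differentiable on `D`, and
`|⟨D³f(x)[v] u, u⟩| ≤ M ‖u‖ₓ² ‖v‖ₓ ^ (ν - 2) ‖v‖₂ ^ (3 - ν)`. -/
structure IsGSC {n : ℕ} (D : Set (EuclideanSpace ℝ (Fin n))) (f : EuclideanSpace ℝ (Fin n) → ℝ)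
    (M ν : ℝ) : Prop where
  isOpen_dom : IsOpen D
  convex : ConvexOn ℝ D f
  isClosed_epigraph : IsClosed {p : EuclideanSpace ℝ (Fin n) × ℝ | p.1 ∈ D ∧ f p.1 ≤ p.2}
  contDiffOn : ContDiffOn ℝ 3 f D
  bound : ∀ x ∈ D, ∀ u v : EuclideanSpace ℝ (Fin n),
    |iteratedFDeriv ℝ 3 f x ![v, u, u]| ≤
      M * localNorm f x u ^ 2 * localNorm f x v ^ (ν - 2) * ‖v‖ ^ (3 - ν)

/-! ### The polytope -/

/-- The polyhedron `{x | B x ≤ b}`. -/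
def polytope {m n : ℕ} (B : Matrix (Fin m) (Fin n) ℝ) (b : Fin m → ℝ) :
    Set (EuclideanSpace ℝ (Fin n)) :=
  {x | ∀ i, (B *ᵥ x.ofLp) i ≤ b i}

/-- The set `𝒰` of vertices (extreme points) of `{x | B x ≤ b}`. -/
def vertices {m n : ℕ} (B : Matrix (Fin m) (Fin n) ℝ) (b : Fin m → ℝ) :
    Set (EuclideanSpace ℝ (Fin n)) :=
  (polytope B b).extremePoints ℝ

/-- `I(V)`: the constraints that bind at every point of `V`. -/
def binding {m n : ℕ} (B : Matrix (Fin m) (Fin n) ℝ) (b : Fin m → ℝ)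
    (V : Set (EuclideanSpace ℝ (Fin n))) : Set (Fin m) :=
  {i | ∀ u ∈ V, (B *ᵥ u.ofLp) i = b i}

/-- `ζ`: the least positive slack of a constraint at a vertex. -/
def zeta {m n : ℕ} (B : Matrix (Fin m) (Fin n) ℝ) (b : Fin m → ℝ) : ℝ :=
  sInf {r | ∃ u ∈ vertices B b, ∃ i, (B *ᵥ u.ofLp) i < b i ∧ r = b i - (B *ᵥ u.ofLp) i}

/-- `φ`: the largest Euclidean norm of a row of `B` whose constraint does not bind on the whole
polytope. -/
def phi {m n : ℕ} (B : Matrix (Fin m) (Fin n) ℝ) (b : Fin m → ℝ) : ℝ :=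
  sSup {r | ∃ i, i ∉ binding B b (vertices B b) ∧ r = ‖WithLp.toLp 2 (B i)‖}

/-- The vertex-facet distance `Ω_𝒳 = ζ / φ`. -/
def vertexFacetDist {m n : ℕ} (B : Matrix (Fin m) (Fin n) ℝ) (b : Fin m → ℝ) : ℝ :=
  zeta B b / phi B b

/-! ### Solutions, level set, extreme curvatures -/

/-- The minimizers of `f` over `X ∩ D`. -/
def solutionSet {n : ℕ} (D X : Set (EuclideanSpace ℝ (Fin n)))
    (f : EuclideanSpace ℝ (Fin n) → ℝ) : Set (EuclideanSpace ℝ (Fin n)) :=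
  {x | x ∈ X ∩ D ∧ ∀ y ∈ X ∩ D, f x ≤ f y}

/-- The level set `𝒮(x₀) = {x ∈ X ∩ D | f x ≤ f x₀}`. -/
def levelSet {n : ℕ} (D X : Set (EuclideanSpace ℝ (Fin n)))
    (f : EuclideanSpace ℝ (Fin n) → ℝ) (x₀ : EuclideanSpace ℝ (Fin n)) :
    Set (EuclideanSpace ℝ (Fin n)) :=
  {x | x ∈ X ∩ D ∧ f x ≤ f x₀}

/-- All eigenvalues of all Hessians of `f` at points of `S`. -/
def hessianEigenvalues {n : ℕ} (f : EuclideanSpace ℝ (Fin n) → ℝ)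
    (S : Set (EuclideanSpace ℝ (Fin n))) : Set ℝ :=
  {r | ∃ x ∈ S, Module.End.HasEigenvalue
    (hessian f x : EuclideanSpace ℝ (Fin n) →ₗ[ℝ] EuclideanSpace ℝ (Fin n)) r}

/-- `L = max_{x ∈ S} λ_max (∇²f(x))`. -/
def maxCurv {n : ℕ} (f : EuclideanSpace ℝ (Fin n) → ℝ)
    (S : Set (EuclideanSpace ℝ (Fin n))) : ℝ :=
  sSup (hessianEigenvalues f S)

/-- `σ = min_{x ∈ S} λ_min (∇²f(x))`. -/
def minCurv {n : ℕ} (f : EuclideanSpace ℝ (Fin n) → ℝ)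
    (S : Set (EuclideanSpace ℝ (Fin n))) : ℝ :=
  sInf (hessianEigenvalues f S)

/-! ### The step size -/

/-- `δ_ν` as a function of `β = ‖v‖₂` and `e = ‖v‖ₓ`. -/
def delta (ν β e : ℝ) : ℝ :=
  if ν = 2 then β else (ν - 2) / 2 * β ^ (3 - ν) * e ^ (ν - 2)

/-- The function `ω_ν` for `2 ≤ ν ≤ 3`, continuously extended by `ω_ν(0) = 1/2`; for `ν > 2` it is
only meaningful at arguments smaller than `1`. -/
def omega (ν t : ℝ) : ℝ :=
  if t = 0 then 1 / 2
  else if ν = 2 then (Real.exp t - t - 1) / t ^ 2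
  else if ν = 3 then (-t - Real.log (1 - t)) / t ^ 2
  else (ν - 2) / (4 - ν) * (1 / t) *
    ((ν - 2) / (2 * (3 - ν) * t) * ((1 - t) ^ (2 * (3 - ν) / (2 - ν)) - 1) - 1)

/-- Membership of `t` in the domain of `ω_ν` (as a function on `[0, ∞)`). -/
def InOmegaDom (ν t : ℝ) : Prop :=
  ν = 2 ∨ t < 1

/-- The upper model `t ↦ -t G + t² e² ω_ν(t M δ_ν)` of the change of `f` along a direction. -/
def upperModel (M ν G β e t : ℝ) : ℝ :=
  -(t * G) + t ^ 2 * e ^ 2 * omega ν (t * (M * delta ν β e))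

/-- The closed-form unconstrained step `𝚝_ν`. -/
def closedStep (M ν G β e : ℝ) : ℝ :=
  if ν = 2 then
    1 / (M * delta ν β e) * Real.log (1 + G * (M * delta ν β e) / e ^ 2)
  else if ν = 3 then
    G / (M * delta ν β e * G + e ^ 2)
  else
    1 / (M * delta ν β e) *
      (1 - (1 + M * delta ν β e * G / e ^ 2 * ((4 - ν) / (ν - 2))) ^ (-((ν - 2) / (4 - ν))))

/-- `α` is the step size for the bound `tbar`: a minimizer of the upper model over `[0, tbar]`
(within the domain of the model), or the closed form `min {tbar, 𝚝_ν}`. -/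
def IsStepSize (M ν G β e tbar α : ℝ) : Prop :=
  (α ∈ Set.Icc 0 tbar ∧ InOmegaDom ν (α * (M * delta ν β e)) ∧
    ∀ t ∈ Set.Icc 0 tbar, InOmegaDom ν (t * (M * delta ν β e)) →
      upperModel M ν G β e α ≤ upperModel M ν G β e t) ∨
  α = min tbar (closedStep M ν G β e)

/-! ### The away-step method -/

/-- `μ` is a vertex representation of `x`: nonnegative weights on the vertices, of total mass one,
with barycenter `x`. -/
def IsVertexRep {m n : ℕ} (B : Matrix (Fin m) (Fin n) ℝ) (b : Fin m → ℝ)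
    (x : EuclideanSpace ℝ (Fin n)) (μ : EuclideanSpace ℝ (Fin n) →₀ ℝ) : Prop :=
  (∀ u ∈ μ.support, u ∈ vertices B b) ∧ (∀ u, 0 ≤ μ u) ∧
    (μ.sum fun _ w => w) = 1 ∧ (μ.sum fun u w => w • u) = x

/-- The test that selects a forward step. -/
def IsForward {n : ℕ} (f : EuclideanSpace ℝ (Fin n) → ℝ) (x s u : EuclideanSpace ℝ (Fin n)) :
    Prop :=
  inner ℝ (gradient f x) (s - x) ≤ inner ℝ (gradient f x) (x - u)

open Classical in
/-- The search direction: `s - x` in a forward step, `x - u` in an away step. -/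
def direction {n : ℕ} (f : EuclideanSpace ℝ (Fin n) → ℝ) (x s u : EuclideanSpace ℝ (Fin n)) :
    EuclideanSpace ℝ (Fin n) :=
  if IsForward f x s u then s - x else x - u

/-- The modified gap `G = -⟨∇f(x), v⟩`. -/
def modGap {n : ℕ} (f : EuclideanSpace ℝ (Fin n) → ℝ) (x s u : EuclideanSpace ℝ (Fin n)) : ℝ :=
  -inner ℝ (gradient f x) (direction f x s u)

open Classical in
/-- The largest admissible step: `1` in a forward step, `μ_u / (1 - μ_u)` in an away step. -/
def maxStep {n : ℕ} (f : EuclideanSpace ℝ (Fin n) → ℝ) (x s u : EuclideanSpace ℝ (Fin n))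
    (μ : EuclideanSpace ℝ (Fin n) →₀ ℝ) : ℝ :=
  if IsForward f x s u then 1 else μ u / (1 - μ u)

open Classical in
/-- The weights of `x + α v` that are induced by the weights `μ` of `x`. -/
def updateWeights {n : ℕ} (f : EuclideanSpace ℝ (Fin n) → ℝ) (x s u : EuclideanSpace ℝ (Fin n))
    (μ : EuclideanSpace ℝ (Fin n) →₀ ℝ) (α : ℝ) : EuclideanSpace ℝ (Fin n) →₀ ℝ :=
  if IsForward f x s u then (1 - α) • μ + Finsupp.single s α
  else (1 + α) • μ - Finsupp.single u α

/-- A trajectory of the away-step method. The new weights are a vertex representation of the new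
point supported in the support of the updated weights, so that every representation reduction
(in particular none) is allowed. -/
structure IsRun {m n : ℕ} (B : Matrix (Fin m) (Fin n) ℝ) (b : Fin m → ℝ)
    (D : Set (EuclideanSpace ℝ (Fin n))) (f : EuclideanSpace ℝ (Fin n) → ℝ) (M ν : ℝ)
    (x s u : ℕ → EuclideanSpace ℝ (Fin n)) (μ : ℕ → EuclideanSpace ℝ (Fin n) →₀ ℝ)
    (α : ℕ → ℝ) : Prop where
  init_mem : x 0 ∈ D ∩ vertices B b
  init_weights : μ 0 = Finsupp.single (x 0) 1
  oracle_vertex : ∀ k, s k ∈ vertices B b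
  oracle_min : ∀ k, ∀ d ∈ polytope B b,
    inner ℝ (gradient f (x k)) (s k) ≤ inner ℝ (gradient f (x k)) d
  away_mem : ∀ k, u k ∈ (μ k).support
  away_max : ∀ k, ∀ w ∈ (μ k).support,
    inner ℝ (gradient f (x k)) w ≤ inner ℝ (gradient f (x k)) (u k)
  step : ∀ k, IsStepSize M ν (modGap f (x k) (s k) (u k))
    ‖direction f (x k) (s k) (u k)‖ (localNorm f (x k) (direction f (x k) (s k) (u k)))
    (maxStep f (x k) (s k) (u k) (μ k)) (α k)
  next : ∀ k, x (k + 1) = x k + α k • direction f (x k) (s k) (u k)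
  weights_rep : ∀ k, IsVertexRep B b (x (k + 1)) (μ (k + 1))
  weights_support : ∀ k,
    (μ (k + 1)).support ⊆ (updateWeights f (x k) (s k) (u k) (μ k) (α k)).support

/-! ### The rate -/

/-- `γ̃_ν = 1 + (4 - ν) / (2 (3 - ν)) (1 - 2 ^ (2 (3 - ν) / (4 - ν)))`. -/
def gammaTilde (ν : ℝ) : ℝ :=
  1 + (4 - ν) / (2 * (3 - ν)) * (1 - (2 : ℝ) ^ (2 * (3 - ν) / (4 - ν)))

/-- The constant `c₁(M, ν)`, for the curvature bound `L` and the diameter `d`. -/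
def c1 (M ν L d : ℝ) : ℝ :=
  if ν = 2 then min (1 / 2) ((2 * Real.log 2 - 1) / (M * d))
  else if ν = 3 then min (1 / 2) (2 * (1 - Real.log 2) / (M * Real.sqrt L * d))
  else min (1 / 2) (gammaTilde ν / (d * (ν / 2 - 1) * M * L ^ ((ν - 2) / 2)))

/-- The constant `c₂(M, ν)` (which does not depend on `M`), for the curvature bound `L` and the
diameter `d`. -/
def c2 (ν L d : ℝ) : ℝ :=
  if ν = 2 then (2 * Real.log 2 - 1) / (L * d ^ 2)
  else if ν = 3 then 2 * (1 - Real.log 2) / (L * d ^ 2)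
  else -1 / ((2 - ν) / (4 - ν)) * (gammaTilde ν / (d ^ 2 * L))

/-- `Ω = Ω_𝒳 / |𝒰|`. -/
def Omega {m n : ℕ} (B : Matrix (Fin m) (Fin n) ℝ) (b : Fin m → ℝ) : ℝ :=
  vertexFacetDist B b / (vertices B b).ncard

/-- `θ = min {1/2, c₁ Ω / (2 diam 𝒳), c₂ Ω² σ / 8}`, with `L` and `σ` taken over `𝒮(x₀)`. -/
def theta {m n : ℕ} (B : Matrix (Fin m) (Fin n) ℝ) (b : Fin m → ℝ)
    (D : Set (EuclideanSpace ℝ (Fin n))) (f : EuclideanSpace ℝ (Fin n) → ℝ) (M ν : ℝ)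
    (x₀ : EuclideanSpace ℝ (Fin n)) : ℝ :=
  min (1 / 2) (min
    (c1 M ν (maxCurv f (levelSet D (polytope B b) f x₀)) (Metric.diam (polytope B b)) *
      Omega B b / (2 * Metric.diam (polytope B b)))
    (c2 ν (maxCurv f (levelSet D (polytope B b) f x₀)) (Metric.diam (polytope B b)) *
      Omega B b ^ 2 * minCurv f (levelSet D (polytope B b) f x₀) / 8))

end

end ASFW

/-! The proof follows the away-step argument: a step that is not cut off by the bound on the step
size decreases the optimality gap `h` by a fixed factor, and the other steps can be counted.

*The model.* Put `ψ(t) = t² ω_ν(t)`. Its second derivative `rho` is the extremal solution of the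
differential inequality that generalized self-concordance imposes on `t ↦ ⟨∇²f(x + t v) v, v⟩`, so
that `f(x + t v)` lies below the upper model as long as the model is finite
(`mem_and_le_upperModel`); the closed epigraph keeps the segment inside the domain. Both step size
rules minimize the model over the admissible steps (`IsStepSize.isMin`). Evaluating the model at one
well-chosen point gives a decrease that is linear or quadratic in the gap `G`
(`upperModel_le_of_lt`), and `G / 2` for a full forward step (`upperModel_one_le`).

*The gap.* Moving mass from the active vertices of `x` to the polytope, until blocked by a
constraint, shows that `⟨∇f(x), u - s⟩`, for the away vertex `u` and the forward vertex `s`, is at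
least `Ω ⟨∇f(x), x - y⟩ / ‖x - y‖` for each `y` in the polytope (`Omega_mul_inner_le`). For the
minimizer `y` at distance `r`, strong convexity on the level set gives `⟨∇f(x), x - y⟩ ≥ h + σ r² /
2`, hence `G ≥ h`, `2 d G ≥ Ω h` and `2 G² ≥ Ω² σ h`. The last estimate is four times stronger than
the one that `θ` calls for; at `ν = 3`, where `c₂` exceeds the coefficient of the quadratic decrease
by the factor `2`, this margin is needed. So `h` shrinks by `1 - θ` except in an away step of
maximal length (`step_decrease`).

*Counting.* An away step of maximal length removes a vertex from the support, every other step adds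
at most one, and the support starts with one vertex. So at least half of the steps shrink `h`
(`IsRun.exists_good_steps`). -/

namespace ASFW

noncomputable section

/-! ### The function `ω_ν` and its primitives -/

/-- `ψ_ν(t) = t² ω_ν(t)`, the model of the growth of a generalized self-concordant function in
scaled time. -/
def psi (ν t : ℝ) : ℝ := t ^ 2 * omega ν t

/-- The derivative of `ψ_ν`. -/
def psiDeriv (ν t : ℝ) : ℝ :=
  if ν = 2 then Real.exp t - 1
  else (ν - 2) / (4 - ν) * ((1 - t) ^ (-((4 - ν) / (ν - 2))) - 1)

/-- The second derivative of `ψ_ν`: the largest possible growth of the second derivative of a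
generalized self-concordant function of one variable, in scaled time. -/
def rho (ν t : ℝ) : ℝ :=
  if ν = 2 then Real.exp t else (1 - t) ^ (-(2 / (ν - 2)))

lemma InOmegaDom.mono {ν s t : ℝ} (ht : InOmegaDom ν t) (h : s ≤ t) : InOmegaDom ν s :=
  ht.imp id fun h' => h.trans_lt h'

lemma isOpen_omegaDom (ν : ℝ) : IsOpen {t | InOmegaDom ν t} := by
  have h : {t | InOmegaDom ν t} = {_t : ℝ | ν = 2} ∪ Set.Iio 1 := rfl
  rw [h]
  exact isOpen_const.union isOpen_Iio

lemma convex_omegaDom (ν : ℝ) : Convex ℝ {t | InOmegaDom ν t} := by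
  refine Set.OrdConnected.convex ⟨fun x _ y hy z hz => ?_⟩
  exact InOmegaDom.mono hy hz.2

lemma psi_two (t : ℝ) : psi 2 t = Real.exp t - t - 1 := by
  unfold psi omega
  rw [if_pos rfl]
  split_ifs with h
  · simp [h]
  · field_simp

lemma psi_three (t : ℝ) : psi 3 t = -t - Real.log (1 - t) := by
  unfold psi omega
  rw [if_neg (show (3 : ℝ) ≠ 2 by norm_num), if_pos rfl]
  split_ifs with h
  · simp [h]
  · field_simp

lemma psi_of_mem_Ioo {ν : ℝ} (h2 : 2 < ν) (h3 : ν < 3) (t : ℝ) :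
    psi ν t = (ν - 2) / (4 - ν) *
      ((ν - 2) / (2 * (3 - ν)) * ((1 - t) ^ (2 * (3 - ν) / (2 - ν)) - 1) - t) := by
  unfold psi omega
  have h4 : 4 - ν ≠ 0 := by linarith
  have h5 : 3 - ν ≠ 0 := by linarith
  rw [if_neg h2.ne', if_neg h3.ne]
  split_ifs with h
  · simp [h]
  · field_simp

lemma psi_zero (ν : ℝ) : psi ν 0 = 0 := by simp [psi]

lemma psiDeriv_zero (ν : ℝ) : psiDeriv ν 0 = 0 := by simp [psiDeriv]

lemma hasDerivAt_psi {ν t : ℝ} (hν : ν ∈ Set.Icc (2 : ℝ) 3) (ht : InOmegaDom ν t) :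
    HasDerivAt (psi ν) (psiDeriv ν t) t := by
  rcases hν.1.eq_or_lt with rfl | h2
  · rw [funext psi_two]
    simpa [psiDeriv] using ((Real.hasDerivAt_exp t).sub (hasDerivAt_id t)).sub_const 1
  have ht1 : 0 < 1 - t := by
    rcases ht with h | h
    · linarith
    · linarith
  have hd : HasDerivAt (fun s : ℝ => 1 - s) (-1) t := by
    simpa using (hasDerivAt_id t).const_sub 1
  rcases hν.2.eq_or_lt with rfl | h3
  · rw [funext psi_three]
    refine ((hasDerivAt_id t).neg.sub (hd.log ht1.ne')).congr_deriv ?_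
    norm_num [psiDeriv, Real.rpow_neg ht1.le]
    field_simp
    ring
  · rw [funext (psi_of_mem_Ioo h2 h3)]
    refine ((((hd.rpow_const (p := 2 * (3 - ν) / (2 - ν)) (Or.inl ht1.ne')).sub_const 1).const_mul
      ((ν - 2) / (2 * (3 - ν)))).sub (hasDerivAt_id t)).const_mul ((ν - 2) / (4 - ν))
      |>.congr_deriv ?_
    have h4 : 2 * (3 - ν) / (2 - ν) - 1 = -((4 - ν) / (ν - 2)) := by
      have : 2 - ν ≠ 0 := by linarith
      have : ν - 2 ≠ 0 := by linarith
      field_simp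
      ring
    rw [psiDeriv, if_neg h2.ne', h4]
    have : 2 - ν ≠ 0 := by linarith
    have : 3 - ν ≠ 0 := by linarith
    have : 4 - ν ≠ 0 := by linarith
    field_simp
    ring

lemma hasDerivAt_psiDeriv {ν t : ℝ} (hν : ν ∈ Set.Icc (2 : ℝ) 3) (ht : InOmegaDom ν t) :
    HasDerivAt (psiDeriv ν) (rho ν t) t := by
  rcases hν.1.eq_or_lt with rfl | h2
  · have : psiDeriv 2 = fun t => Real.exp t - 1 := by ext; simp [psiDeriv]
    rw [this]
    simpa [rho] using (Real.hasDerivAt_exp t).sub_const 1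
  have ht1 : 0 < 1 - t := by
    rcases ht with h | h
    · linarith
    · linarith
  have hd : HasDerivAt (fun s : ℝ => 1 - s) (-1) t := by
    simpa using (hasDerivAt_id t).const_sub 1
  have : psiDeriv ν = fun t => (ν - 2) / (4 - ν) * ((1 - t) ^ (-((4 - ν) / (ν - 2))) - 1) := by
    ext; rw [psiDeriv, if_neg h2.ne']
  rw [this]
  refine (((hd.rpow_const (p := -((4 - ν) / (ν - 2))) (Or.inl ht1.ne')).sub_const 1).const_mul
      ((ν - 2) / (4 - ν))).congr_deriv ?_
  have h5 : ν - 2 ≠ 0 := by linarith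
  have h4 : 4 - ν ≠ 0 := by linarith [hν.2]
  have h6 : -((4 - ν) / (ν - 2)) - 1 = -(2 / (ν - 2)) := by
    field_simp
    ring
  rw [rho, if_neg h2.ne', h6]
  field_simp

lemma rho_pos {ν t : ℝ} (ht : InOmegaDom ν t) : 0 < rho ν t := by
  unfold rho
  split_ifs with h
  · exact Real.exp_pos t
  · exact Real.rpow_pos_of_pos (by linarith [ht.resolve_left h]) _

lemma rho_mono {ν s t : ℝ} (hν : ν ∈ Set.Icc (2 : ℝ) 3) (hst : s ≤ t) (ht : InOmegaDom ν t) :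
    rho ν s ≤ rho ν t := by
  unfold rho
  split_ifs with h
  · exact Real.exp_le_exp.2 hst
  · have := ht.resolve_left h
    have h2 : 0 < ν - 2 := by
      have := lt_of_le_of_ne hν.1 (Ne.symm h)
      linarith
    exact Real.rpow_le_rpow_of_nonpos (by linarith) (by linarith)
      (neg_nonpos.2 (by positivity))

lemma convexOn_psi {ν : ℝ} (hν : ν ∈ Set.Icc (2 : ℝ) 3) :
    ConvexOn ℝ {t | InOmegaDom ν t} (psi ν) := by
  have hint := (isOpen_omegaDom ν).interior_eq
  refine MonotoneOn.convexOn_of_deriv (convex_omegaDom ν)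
    (fun t ht => (hasDerivAt_psi hν ht).continuousAt.continuousWithinAt)
    (fun t ht => ?_) ?_
  · rw [hint] at ht
    exact (hasDerivAt_psi hν ht).differentiableAt.differentiableWithinAt
  · rw [hint]
    intro s hs t ht hst
    rw [(hasDerivAt_psi hν hs).deriv, (hasDerivAt_psi hν ht).deriv]
    refine monotoneOn_of_deriv_nonneg (convex_omegaDom ν)
      (fun t ht => (hasDerivAt_psiDeriv hν ht).continuousAt.continuousWithinAt)
      (fun t ht => ?_) (fun t ht => ?_) hs ht hst
    · rw [hint] at ht
      exact (hasDerivAt_psiDeriv hν ht).differentiableAt.differentiableWithinAt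
    · rw [hint] at ht
      rw [(hasDerivAt_psiDeriv hν ht).deriv]
      exact (rho_pos ht).le

/-- A differentiable function on `[0, T]` with nonnegative derivative that vanishes at `0` is
nonnegative at `T`. -/
lemma nonneg_of_hasDerivAt_nonneg {F F' : ℝ → ℝ} {T : ℝ} (hT : 0 ≤ T) (h0 : F 0 = 0)
    (hF : ∀ t ∈ Set.Icc 0 T, HasDerivAt F (F' t) t) (hF' : ∀ t ∈ Set.Icc 0 T, 0 ≤ F' t) :
    0 ≤ F T := by
  rw [← h0]
  refine monotoneOn_of_deriv_nonneg (convex_Icc 0 T)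
    (fun t ht => (hF t ht).continuousAt.continuousWithinAt) (fun t ht => ?_) (fun t ht => ?_)
    (Set.left_mem_Icc.2 hT) (Set.right_mem_Icc.2 hT) hT
  · exact (hF t (interior_subset ht)).differentiableAt.differentiableWithinAt
  · rw [(hF t (interior_subset ht)).deriv]
    exact hF' t (interior_subset ht)

/-- `ψ_ν(s t) ≤ s² ψ_ν(t)`: equivalently, `ω_ν` is nondecreasing. -/
lemma psi_mul_le {ν s t : ℝ} (hν : ν ∈ Set.Icc (2 : ℝ) 3) (hs : s ∈ Set.Icc (0 : ℝ) 1)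
    (ht0 : 0 ≤ t) (ht : InOmegaDom ν t) : psi ν (s * t) ≤ s ^ 2 * psi ν t := by
  have hdom : ∀ r ∈ Set.Icc 0 t, InOmegaDom ν r ∧ InOmegaDom ν (s * r) := fun r hr =>
    ⟨ht.mono hr.2, ht.mono ((mul_le_of_le_one_left hr.1 hs.2).trans hr.2)⟩
  have hlin (r : ℝ) : HasDerivAt (fun r => s * r) s r := by
    simpa using (hasDerivAt_id r).const_mul s
  have h1 : ∀ r ∈ Set.Icc 0 t, 0 ≤ s * psiDeriv ν r - psiDeriv ν (s * r) := fun r hr =>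
    nonneg_of_hasDerivAt_nonneg (F := fun r => s * psiDeriv ν r - psiDeriv ν (s * r))
      (F' := fun r => s * rho ν r - rho ν (s * r) * s) hr.1 (by simp [psiDeriv_zero])
      (fun q hq => ((hasDerivAt_psiDeriv hν (hdom q ⟨hq.1, hq.2.trans hr.2⟩).1).const_mul s).sub
        ((hasDerivAt_psiDeriv hν (hdom q ⟨hq.1, hq.2.trans hr.2⟩).2).comp q (hlin q)))
      (fun q hq => by
        have := rho_mono hν (mul_le_of_le_one_left hq.1 hs.2) (hdom q ⟨hq.1, hq.2.trans hr.2⟩).1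
        nlinarith [hs.1])
  have h2 := nonneg_of_hasDerivAt_nonneg (F := fun r => s ^ 2 * psi ν r - psi ν (s * r))
    (F' := fun r => s ^ 2 * psiDeriv ν r - psiDeriv ν (s * r) * s) ht0 (by simp [psi_zero])
    (fun q hq => ((hasDerivAt_psi hν (hdom q hq).1).const_mul (s ^ 2)).sub
        ((hasDerivAt_psi hν (hdom q hq).2).comp q (hlin q)))
    (fun q hq => by nlinarith [h1 q hq, hs.1])
  simpa using h2

lemma psi_nonneg {ν t : ℝ} (hν : ν ∈ Set.Icc (2 : ℝ) 3) (ht0 : 0 ≤ t) (ht : InOmegaDom ν t) :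
    0 ≤ psi ν t := by
  have h1 : ∀ r ∈ Set.Icc 0 t, 0 ≤ psiDeriv ν r := fun r hr =>
    nonneg_of_hasDerivAt_nonneg hr.1 (psiDeriv_zero ν)
      (fun q hq => hasDerivAt_psiDeriv hν (ht.mono (hq.2.trans hr.2)))
      (fun q hq => (rho_pos (ht.mono (hq.2.trans hr.2))).le)
  exact nonneg_of_hasDerivAt_nonneg ht0 (psi_zero ν)
    (fun q hq => hasDerivAt_psi hν (ht.mono hq.2)) h1

/-! ### The step size -/

/-- The slope at which the lower bound for the conjugate of `ψ_ν` changes from quadratic to linear.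
It is the exponent `(ν - 2) / (4 - ν)` of the closed-form step, and `1` for `ν = 2`. -/
def threshold (ν : ℝ) : ℝ := if ν = 2 then 1 else (ν - 2) / (4 - ν)

/-- The value of the conjugate of `ψ_ν` at `threshold ν`, divided by `threshold ν`. -/
def gain (ν : ℝ) : ℝ :=
  if ν = 2 then 2 * Real.log 2 - 1 else if ν = 3 then 1 - Real.log 2 else gammaTilde ν

lemma threshold_pos {ν : ℝ} (hν : ν ∈ Set.Icc (2 : ℝ) 3) : 0 < threshold ν := by
  unfold threshold
  split_ifs with h
  · exact one_pos
  · have h2 := lt_of_le_of_ne hν.1 (Ne.symm h)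
    exact div_pos (by linarith) (by linarith [hν.2])

lemma gain_pos {ν : ℝ} (hν : ν ∈ Set.Icc (2 : ℝ) 3) : 0 < gain ν := by
  unfold gain
  split_ifs with h h'
  · linarith [Real.log_two_gt_d9]
  · linarith [Real.log_two_lt_d9]
  · have h2 := lt_of_le_of_ne hν.1 (Ne.symm h)
    have h3 := lt_of_le_of_ne hν.2 h'
    have hq0 : 0 < 2 * (3 - ν) / (4 - ν) := div_pos (by linarith) (by linarith)
    have hq1 : 2 * (3 - ν) / (4 - ν) < 1 := by rw [div_lt_one (by linarith)]; linarith
    -- Bernoulli's inequality `2 ^ q < 1 + q` for `0 < q < 1`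
    have hb := rpow_one_add_lt_one_add_mul_self (s := 1) (by norm_num) one_ne_zero hq0 hq1
    have hinv : (4 - ν) / (2 * (3 - ν)) = (2 * (3 - ν) / (4 - ν))⁻¹ := by rw [inv_div]
    rw [gammaTilde, hinv]
    norm_num at hb
    have h4 : 0 < (2 * (3 - ν) / (4 - ν))⁻¹ *
        (1 + 2 * (3 - ν) / (4 - ν) - 2 ^ (2 * (3 - ν) / (4 - ν))) :=
      mul_pos (inv_pos.2 hq0) (by linarith)
    have h5 : (2 * (3 - ν) / (4 - ν))⁻¹ * (2 * (3 - ν) / (4 - ν)) = 1 := inv_mul_cancel₀ hq0.ne'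
    nlinarith

/-- The point at which the conjugate of `ψ_ν` attains its value at `threshold ν`. -/
lemma exists_psi_eq {ν : ℝ} (hν : ν ∈ Set.Icc (2 : ℝ) 3) :
    ∃ T, 0 ≤ T ∧ InOmegaDom ν T ∧ psi ν T = threshold ν * (T - gain ν) := by
  rcases hν.1.eq_or_lt with rfl | h2
  · refine ⟨Real.log 2, (Real.log_pos one_lt_two).le, Or.inl rfl, ?_⟩
    rw [psi_two, Real.exp_log two_pos, threshold, gain, if_pos rfl, if_pos rfl]
    ring
  rcases hν.2.eq_or_lt with rfl | h3
  · refine ⟨1 / 2, by norm_num, Or.inr (by norm_num), ?_⟩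
    have : Real.log (1 - 1 / 2) = -Real.log 2 := by
      rw [← Real.log_inv]; norm_num
    rw [psi_three, this]
    norm_num [threshold, gain]
    ring
  · have h4 : 0 < 4 - ν := by linarith
    have h5 : 0 < ν - 2 := by linarith
    have h6 : 0 < 3 - ν := by linarith
    have hp : 0 < (ν - 2) / (4 - ν) := div_pos h5 h4
    refine ⟨1 - 2 ^ (-((ν - 2) / (4 - ν))), ?_, Or.inr ?_, ?_⟩
    · have := Real.rpow_le_one_of_one_le_of_nonpos one_le_two (neg_nonpos.2 hp.le)
      linarith
    · have : (0 : ℝ) < 2 ^ (-((ν - 2) / (4 - ν))) := by positivity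
      linarith
    · rw [psi_of_mem_Ioo h2 h3, sub_sub_cancel, ← Real.rpow_mul zero_le_two, threshold, gain,
        if_neg h2.ne', if_neg h2.ne', if_neg h3.ne, gammaTilde]
      have e1 : -((ν - 2) / (4 - ν)) * (2 * (3 - ν) / (2 - ν)) = 2 * (3 - ν) / (4 - ν) := by
        have : 2 - ν ≠ 0 := by linarith
        field_simp
        ring
      have e2 : (2 : ℝ) ^ (-((ν - 2) / (4 - ν))) = 2 ^ (2 * (3 - ν) / (4 - ν)) / 2 := by
        rw [← Real.rpow_sub_one two_ne_zero]
        congr 1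
        field_simp
        ring
      rw [e1, e2]
      field_simp
      ring

lemma upperModel_eq {M ν G β e t : ℝ} (ha : 0 < M * delta ν β e) (he : 0 < e) :
    upperModel M ν G β e t = e ^ 2 / (M * delta ν β e) ^ 2 *
      (psi ν (t * (M * delta ν β e)) -
        M * delta ν β e * G / e ^ 2 * (t * (M * delta ν β e))) := by
  rw [upperModel, psi]
  generalize M * delta ν β e = a at *
  field_simp
  ring

lemma convexOn_upperModel {M ν G β e : ℝ} (hν : ν ∈ Set.Icc (2 : ℝ) 3)
    (ha : 0 < M * delta ν β e) (he : 0 < e) :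
    ConvexOn ℝ {t | InOmegaDom ν (t * (M * delta ν β e))} (upperModel M ν G β e) := by
  rw [show upperModel M ν G β e = _ from funext fun t => upperModel_eq (t := t) ha he]
  refine ConvexOn.smul (by positivity) ?_
  have h1 := (convexOn_psi hν).comp_linearMap (LinearMap.mulRight ℝ (M * delta ν β e))
  refine h1.sub (LinearMap.concaveOn ((M * delta ν β e * G / e ^ 2 * (M * delta ν β e)) •
    LinearMap.id) h1.1) |>.congr fun t _ => ?_
  simp
  ring_nf

/-- The closed-form step is the critical point of the upper model. -/
lemma closedStep_spec {M ν G β e : ℝ} (hν : ν ∈ Set.Icc (2 : ℝ) 3)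
    (ha : 0 < M * delta ν β e) (he : 0 < e) (hG : 0 ≤ G) :
    0 ≤ closedStep M ν G β e ∧ InOmegaDom ν (closedStep M ν G β e * (M * delta ν β e)) ∧
      psiDeriv ν (closedStep M ν G β e * (M * delta ν β e)) = M * delta ν β e * G / e ^ 2 := by
  unfold closedStep psiDeriv
  generalize M * delta ν β e = a at *
  have hy : 0 ≤ a * G / e ^ 2 := by positivity
  split_ifs with h h'
  · have hy1 : 1 ≤ 1 + G * a / e ^ 2 := by rw [mul_comm G a]; linarith
    refine ⟨mul_nonneg (by positivity) (Real.log_nonneg hy1), Or.inl h, ?_⟩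
    rw [mul_right_comm, one_div_mul_cancel ha.ne', one_mul, Real.exp_log (by linarith)]
    ring
  · have hpos : 0 < a * G + e ^ 2 := by positivity
    have e1 : 1 - G / (a * G + e ^ 2) * a = e ^ 2 / (a * G + e ^ 2) := by
      field_simp
      ring
    have hpos' : 0 < e ^ 2 / (a * G + e ^ 2) := by positivity
    refine ⟨by positivity, Or.inr (by linarith), ?_⟩
    rw [e1, h']
    norm_num [Real.rpow_neg hpos'.le]
    field_simp
    ring
  · have h2 := lt_of_le_of_ne hν.1 (Ne.symm h)
    have h4 : 0 < 4 - ν := by linarith [hν.2]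
    have h5 : 0 < ν - 2 := by linarith
    set w := 1 + a * G / e ^ 2 * ((4 - ν) / (ν - 2)) with hw
    have hw1 : 1 ≤ w := by
      have : 0 ≤ a * G / e ^ 2 * ((4 - ν) / (ν - 2)) := by positivity
      linarith
    have hw0 : 0 < w ^ (-((ν - 2) / (4 - ν))) := Real.rpow_pos_of_pos (by linarith) _
    have hp : 0 < (ν - 2) / (4 - ν) := div_pos h5 h4
    have e1 : 1 / a * (1 - w ^ (-((ν - 2) / (4 - ν)))) * a = 1 - w ^ (-((ν - 2) / (4 - ν))) := by
      field_simp
    rw [e1]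
    refine ⟨mul_nonneg (by positivity) ?_, Or.inr (by linarith), ?_⟩
    · have := Real.rpow_le_one_of_one_le_of_nonpos hw1 (neg_nonpos.2 hp.le)
      linarith
    · have e2 : -((ν - 2) / (4 - ν)) * -((4 - ν) / (ν - 2)) = 1 := by field_simp
      rw [sub_sub_cancel, ← Real.rpow_mul (by linarith), e2, Real.rpow_one, hw]
      field_simp
      ring

lemma upperModel_closedStep_le {M ν G β e t : ℝ} (hν : ν ∈ Set.Icc (2 : ℝ) 3)
    (ha : 0 < M * delta ν β e) (he : 0 < e) (hG : 0 ≤ G)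
    (ht : InOmegaDom ν (t * (M * delta ν β e))) :
    upperModel M ν G β e (closedStep M ν G β e) ≤ upperModel M ν G β e t := by
  obtain ⟨-, hdom, hder⟩ := closedStep_spec hν ha he hG
  rw [upperModel_eq ha he, upperModel_eq ha he]
  refine mul_le_mul_of_nonneg_left ?_ (by positivity)
  rw [← hder]
  have hd := hasDerivAt_psi hν hdom
  rcases lt_trichotomy (closedStep M ν G β e * (M * delta ν β e)) (t * (M * delta ν β e)) with
    h | h | h
  · have := (convexOn_psi hν).le_slope_of_hasDerivAt hdom ht h hd
    rw [slope_def_field, le_div_iff₀ (by linarith)] at this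
    linarith
  · rw [h]
  · have := (convexOn_psi hν).slope_le_of_hasDerivAt ht hdom h hd
    rw [slope_def_field, div_le_iff₀ (by linarith)] at this
    linarith

/-- Both rules for the step size produce a minimizer of the upper model over the admissible
steps. -/
lemma IsStepSize.isMin {M ν G β e tbar α : ℝ} (hν : ν ∈ Set.Icc (2 : ℝ) 3)
    (ha : 0 < M * delta ν β e) (he : 0 < e) (hG : 0 ≤ G) (htbar : 0 ≤ tbar)
    (h : IsStepSize M ν G β e tbar α) :
    α ∈ Set.Icc 0 tbar ∧ InOmegaDom ν (α * (M * delta ν β e)) ∧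
    ∀ t ∈ Set.Icc 0 tbar, InOmegaDom ν (t * (M * delta ν β e)) →
      upperModel M ν G β e α ≤ upperModel M ν G β e t := by
  rcases h with h | rfl
  · exact h
  obtain ⟨h0, hdom, -⟩ := closedStep_spec hν ha he hG
  refine ⟨⟨le_min htbar h0, min_le_left _ _⟩,
    hdom.mono (mul_le_mul_of_nonneg_right (min_le_right _ _) ha.le), fun t ht htd => ?_⟩
  rcases le_total (closedStep M ν G β e) tbar with hle | hle
  · rw [min_eq_right hle]
    exact upperModel_closedStep_le hν ha he hG htd
  · rw [min_eq_left hle]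
    refine ((convexOn_upperModel hν ha he).le_max_of_mem_Icc htd hdom ⟨ht.2, hle⟩).trans ?_
    exact max_le le_rfl (upperModel_closedStep_le hν ha he hG htd)

/-- A step that is not cut off by the bound on the step size decreases the model at least linearly
or quadratically in the gap `G`. The comparison point is `s T / (M δ)`, where `T` attains the
conjugate of `ψ_ν` at the threshold, and `s ≤ 1` is the ratio of the slope to the threshold. -/
lemma upperModel_le_of_lt {M ν G β e tbar α : ℝ} (hν : ν ∈ Set.Icc (2 : ℝ) 3)
    (ha : 0 < M * delta ν β e) (he : 0 < e) (hG : 0 ≤ G)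
    (hα : α ∈ Set.Ico 0 tbar) (hdom : InOmegaDom ν (α * (M * delta ν β e)))
    (hmin : ∀ t ∈ Set.Icc 0 tbar, InOmegaDom ν (t * (M * delta ν β e)) →
      upperModel M ν G β e α ≤ upperModel M ν G β e t) :
    upperModel M ν G β e α ≤ -(gain ν * G / (M * delta ν β e)) ∨
      upperModel M ν G β e α ≤ -(gain ν / threshold ν * G ^ 2 / e ^ 2) := by
  -- by convexity, the minimizer is global
  have hglob : ∀ t, 0 ≤ t → InOmegaDom ν (t * (M * delta ν β e)) →
      upperModel M ν G β e α ≤ upperModel M ν G β e t := by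
    intro t ht htd
    rcases le_or_gt t tbar with h | h
    · exact hmin t ⟨ht, h⟩ htd
    · have hm := hmin tbar ⟨hα.1.trans hα.2.le, le_rfl⟩
        (htd.mono (mul_le_mul_of_nonneg_right h.le ha.le))
      have hαt : 0 < t - α := by linarith [hα.2]
      have hc := (convexOn_upperModel (G := G) hν ha he).2 hdom htd
        (div_nonneg (sub_nonneg.2 h.le) hαt.le) (div_nonneg (sub_nonneg.2 hα.2.le) hαt.le)
        (by field_simp; ring)
      have e1 : (t - tbar) / (t - α) * α + (tbar - α) / (t - α) * t = tbar := by
        field_simp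
        ring
      simp only [smul_eq_mul] at hc
      rw [e1] at hc
      have h3 := hm.trans hc
      have hw : (t - tbar) / (t - α) = 1 - (tbar - α) / (t - α) := by field_simp; ring
      have hb : 0 < (tbar - α) / (t - α) := div_pos (by linarith [hα.2]) hαt
      rw [hw] at h3
      by_contra hcon
      push Not at hcon
      nlinarith
  obtain ⟨T, hT0, hTd, hT⟩ := exists_psi_eq hν
  have hp := threshold_pos hν
  have key (s : ℝ) (hs : s ∈ Set.Icc (0 : ℝ) 1) : upperModel M ν G β e α ≤
      e ^ 2 / (M * delta ν β e) ^ 2 * (psi ν (s * T) - M * delta ν β e * G / e ^ 2 * (s * T)) := by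
    have e1 : s * T / (M * delta ν β e) * (M * delta ν β e) = s * T := div_mul_cancel₀ _ ha.ne'
    have h := hglob (s * T / (M * delta ν β e))
      (div_nonneg (mul_nonneg hs.1 hT0) ha.le)
      (by rw [e1]; exact hTd.mono (mul_le_of_le_one_left hT0 hs.2))
    rwa [upperModel_eq (t := s * T / (M * delta ν β e)) ha he, e1] at h
  have hψ := psi_nonneg hν hT0 hTd
  have hsc := fun s hs => psi_mul_le (s := s) hν hs hT0 hTd
  generalize M * delta ν β e = a at *
  rcases le_total (threshold ν) (a * G / e ^ 2) with h | h
  · left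
    refine (key 1 ⟨zero_le_one, le_rfl⟩).trans ?_
    have e2 : -(gain ν * G / a) = e ^ 2 / a ^ 2 * -(a * G / e ^ 2 * gain ν) := by
      field_simp
    rw [e2, one_mul]
    refine mul_le_mul_of_nonneg_left ?_ (by positivity)
    have : 0 ≤ T - gain ν := by
      rw [hT] at hψ
      exact nonneg_of_mul_nonneg_right hψ hp
    nlinarith
  · right
    have hs : a * G / e ^ 2 / threshold ν ∈ Set.Icc (0 : ℝ) 1 :=
      ⟨by positivity, (div_le_one hp).2 h⟩
    refine (key _ hs).trans ?_
    have e2 : -(gain ν / threshold ν * G ^ 2 / e ^ 2) =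
        e ^ 2 / a ^ 2 * -((a * G / e ^ 2) ^ 2 * gain ν / threshold ν) := by
      field_simp
    rw [e2]
    refine mul_le_mul_of_nonneg_left ?_ (by positivity)
    have h3 := hsc _ hs
    rw [hT] at h3
    have e3 : (a * G / e ^ 2 / threshold ν) ^ 2 * (threshold ν * (T - gain ν)) =
      a * G / e ^ 2 * (a * G / e ^ 2 / threshold ν * T) -
        (a * G / e ^ 2) ^ 2 * gain ν / threshold ν := by
      field_simp
    linarith

/-- A full step halves the linear part of the model: since `ω_ν` is nondecreasing, the model lies
below the parabola with the same value at `1`, and optimality of `1` bounds its curvature. -/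
lemma upperModel_one_le {M ν G β e : ℝ} (hν : ν ∈ Set.Icc (2 : ℝ) 3)
    (ha : 0 < M * delta ν β e) (he : 0 < e)
    (hdom : InOmegaDom ν (1 * (M * delta ν β e)))
    (hmin : ∀ t ∈ Set.Icc (0 : ℝ) 1, InOmegaDom ν (t * (M * delta ν β e)) →
      upperModel M ν G β e 1 ≤ upperModel M ν G β e t) :
    upperModel M ν G β e 1 ≤ -(G / 2) := by
  rw [one_mul] at hdom
  set W := e ^ 2 / (M * delta ν β e) ^ 2 * psi ν (M * delta ν β e) with hW
  have h1 : upperModel M ν G β e 1 = -G + W := by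
    rw [upperModel_eq ha he, hW, one_mul]
    generalize M * delta ν β e = a at *
    field_simp
    ring
  have h2 : ∀ t ∈ Set.Ico (0 : ℝ) 1, (1 + t) * W ≤ G := by
    intro t ht
    have hle := hmin t ⟨ht.1, ht.2.le⟩ (hdom.mono (mul_le_of_le_one_left ha.le ht.2.le))
    have hsc := psi_mul_le hν ⟨ht.1, ht.2.le⟩ ha.le hdom
    have h3 : upperModel M ν G β e t ≤ -(t * G) + t ^ 2 * W := by
      have : -(t * G) + t ^ 2 * W = e ^ 2 / (M * delta ν β e) ^ 2 *
          (t ^ 2 * psi ν (M * delta ν β e) -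
            M * delta ν β e * G / e ^ 2 * (t * (M * delta ν β e))) := by
        rw [hW]
        generalize M * delta ν β e = a at *
        field_simp
        ring
      rw [this, upperModel_eq ha he]
      exact mul_le_mul_of_nonneg_left (by linarith) (by positivity)
    rw [h1] at hle
    have h4 : (1 - t) * ((1 + t) * W) ≤ (1 - t) * G := by linarith
    exact le_of_mul_le_mul_left h4 (by linarith [ht.2])
  have h5 : (1 + 1) * W ≤ G := by
    by_contra hcon
    push Not at hcon
    have hW0 : 0 ≤ W := mul_nonneg (by positivity) (psi_nonneg hν ha.le hdom)
    rcases hW0.eq_or_lt with h | h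
    · have := h2 0 ⟨le_rfl, one_pos⟩
      rw [← h] at this hcon
      linarith
    · have h0 := h2 0 ⟨le_rfl, one_pos⟩
      -- the midpoint between `G / W - 1` and `1` violates the bound
      have := h2 (G / W / 2) ⟨div_nonneg (div_nonneg (by linarith) h.le) zero_le_two, by
        rw [div_div, div_lt_one (by positivity)]; linarith⟩
      have e1 : (1 + G / W / 2) * W = W + G / 2 := by field_simp
      rw [e1] at this
      linarith
  rw [h1]
  linarith

/-! ### Derivatives along lines -/

section Lines

variable {n : ℕ} {D : Set (EuclideanSpace ℝ (Fin n))} {f : EuclideanSpace ℝ (Fin n) → ℝ}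

lemma contDiffAt_gradient (hD : IsOpen D) (hf : ContDiffOn ℝ 3 f D)
    {x : EuclideanSpace ℝ (Fin n)} (hx : x ∈ D) : ContDiffAt ℝ 2 (gradient f) x := by
  have h1 : ContDiffAt ℝ 2 (fderiv ℝ f) x :=
    (hf.contDiffAt (hD.mem_nhds hx)).fderiv_right (by norm_num)
  rw [contDiffAt_euclidean]
  intro i
  have h2 : (fun y => gradient f y i) = fun y => fderiv ℝ f y (EuclideanSpace.single i 1) := by
    ext y
    rw [← inner_gradient_left, EuclideanSpace.inner_single_right]
    simp
  rw [h2]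
  exact h1.clm_apply contDiffAt_const

lemma contDiffAt_hessian (hD : IsOpen D) (hf : ContDiffOn ℝ 3 f D)
    {x : EuclideanSpace ℝ (Fin n)} (hx : x ∈ D) : ContDiffAt ℝ 1 (hessian f) x :=
  (contDiffAt_gradient hD hf hx).fderiv_right (by norm_num)

lemma inner_hessian (hD : IsOpen D) (hf : ContDiffOn ℝ 3 f D)
    {x : EuclideanSpace ℝ (Fin n)} (hx : x ∈ D) (v w : EuclideanSpace ℝ (Fin n)) :
    inner ℝ (hessian f x v) w = fderiv ℝ (fderiv ℝ f) x v w := by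
  have h1 : HasFDerivAt (gradient f) (hessian f x) x :=
    ((contDiffAt_gradient hD hf hx).differentiableAt (by norm_num)).hasFDerivAt
  have h2 : HasFDerivAt (fderiv ℝ f) (fderiv ℝ (fderiv ℝ f) x) x :=
    (((hf.contDiffAt (hD.mem_nhds hx)).fderiv_right (m := 2)
      (by norm_num)).differentiableAt (by norm_num)).hasFDerivAt
  have h3 := h1.inner ℝ (hasFDerivAt_const w x)
  have h4 := h2.clm_apply (hasFDerivAt_const w x)
  have h5 : (fun y => inner ℝ (gradient f y) w) = fun y => fderiv ℝ f y w := by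
    ext y; exact inner_gradient_left
  rw [h5] at h3
  simpa using congrArg (fun L => L v) (h3.unique h4)

lemma hessian_isSymmetric (hD : IsOpen D) (hf : ContDiffOn ℝ 3 f D)
    {x : EuclideanSpace ℝ (Fin n)} (hx : x ∈ D) :
    (hessian f x : EuclideanSpace ℝ (Fin n) →ₗ[ℝ] EuclideanSpace ℝ (Fin n)).IsSymmetric := by
  intro v w
  have hs : IsSymmSndFDerivAt ℝ f x :=
    (hf.contDiffAt (hD.mem_nhds hx)).isSymmSndFDerivAt (by simp; norm_num)
  rw [ContinuousLinearMap.coe_coe, real_inner_comm (hessian f x w) v, inner_hessian hD hf hx,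
    inner_hessian hD hf hx]
  exact hs v w

lemma hasDerivAt_line (x v : EuclideanSpace ℝ (Fin n)) (t : ℝ) :
    HasDerivAt (fun t : ℝ => x + t • v) v t := by
  simpa using ((hasDerivAt_id t).smul_const v).const_add x

lemma hasDerivAt_comp_line (hD : IsOpen D) (hf : ContDiffOn ℝ 3 f D)
    {x v : EuclideanSpace ℝ (Fin n)} {t : ℝ} (hx : x + t • v ∈ D) :
    HasDerivAt (fun t : ℝ => f (x + t • v)) (inner ℝ (gradient f (x + t • v)) v) t := by
  have h1 := ((hf.contDiffAt (hD.mem_nhds hx)).differentiableAt (by norm_num)).hasFDerivAt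
  rw [inner_gradient_left]
  exact h1.comp_hasDerivAt t (hasDerivAt_line x v t)

lemma hasDerivAt_gradient_line (hD : IsOpen D) (hf : ContDiffOn ℝ 3 f D)
    {x v : EuclideanSpace ℝ (Fin n)} {t : ℝ} (hx : x + t • v ∈ D) :
    HasDerivAt (fun t : ℝ => inner ℝ (gradient f (x + t • v)) v)
      (inner ℝ (hessian f (x + t • v) v) v) t := by
  have h1 : HasFDerivAt (gradient f) (hessian f (x + t • v)) (x + t • v) :=
    ((contDiffAt_gradient hD hf hx).differentiableAt (by norm_num)).hasFDerivAt
  simpa using (h1.comp_hasDerivAt t (hasDerivAt_line x v t)).inner ℝ (hasDerivAt_const t v)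

lemma hasDerivAt_hessian_line (hD : IsOpen D) (hf : ContDiffOn ℝ 3 f D)
    {x v : EuclideanSpace ℝ (Fin n)} {t : ℝ} (hx : x + t • v ∈ D) :
    HasDerivAt (fun t : ℝ => inner ℝ (hessian f (x + t • v) v) v)
      (iteratedFDeriv ℝ 3 f (x + t • v) ![v, v, v]) t := by
  set y := x + t • v with hy
  have hQ : DifferentiableAt ℝ (fun z => inner ℝ (hessian f z v) v) y :=
    (((contDiffAt_hessian hD hf hx).differentiableAt (by norm_num)).clm_apply
      (differentiableAt_const v)).inner ℝ (differentiableAt_const v)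
  have h3 : iteratedFDeriv ℝ 3 f y ![v, v, v] =
      fderiv ℝ (fun z => inner ℝ (hessian f z v) v) y v := by
    have hd : DifferentiableAt ℝ (iteratedFDeriv ℝ 2 f) y :=
      (hf.contDiffAt (hD.mem_nhds hx)).differentiableAt_iteratedFDeriv (by norm_num)
    rw [hd.iteratedFDeriv_succ_apply_left']
    have he : (fun z => iteratedFDeriv ℝ 2 f z (Fin.tail ![v, v, v])) =ᶠ[nhds y]
        fun z => inner ℝ (hessian f z v) v := by
      filter_upwards [hD.mem_nhds hx] with z hz
      rw [iteratedFDeriv_two_apply, inner_hessian hD hf hz]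
      rfl
    rw [he.fderiv_eq]
    rfl
  rw [h3]
  exact hQ.hasFDerivAt.comp_hasDerivAt t (hasDerivAt_line x v t)

end Lines

/-! ### The upper bound for generalized self-concordant functions -/

section Descent

variable {n : ℕ} {D : Set (EuclideanSpace ℝ (Fin n))} {f : EuclideanSpace ℝ (Fin n) → ℝ} {M ν : ℝ}

lemma localNorm_sq_of_pos {x v : EuclideanSpace ℝ (Fin n)}
    (h : 0 < inner ℝ (hessian f x v) v) : localNorm f x v ^ 2 = inner ℝ (hessian f x v) v :=
  Real.sq_sqrt h.le

/-- The local norm of a direction grows at most like the extremal solution of the differential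
inequality `|q'| ≤ M ‖v‖^(3-ν) q^(ν/2)` satisfied by `q(t) = ⟨∇²f(x + t v) v, v⟩`. For `ν > 2` this
inequality makes `q^(-(ν-2)/2)` Lipschitz. -/
lemma inner_hessian_line_le (hν : ν ∈ Set.Icc (2 : ℝ) 3) (hf : IsGSC D f M ν)
    {x v : EuclideanSpace ℝ (Fin n)} {T : ℝ} (hT : 0 ≤ T)
    (hD : ∀ t ∈ Set.Icc 0 T, x + t • v ∈ D)
    (hpos : ∀ t ∈ Set.Icc 0 T, 0 < inner ℝ (hessian f (x + t • v) v) v)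
    (hdom : InOmegaDom ν (T * (M * delta ν ‖v‖ (localNorm f x v)))) :
    inner ℝ (hessian f (x + T • v) v) v ≤
      localNorm f x v ^ 2 * rho ν (T * (M * delta ν ‖v‖ (localNorm f x v))) := by
  set q : ℝ → ℝ := fun t => inner ℝ (hessian f (x + t • v) v) v with hq
  set q' : ℝ → ℝ := fun t => iteratedFDeriv ℝ 3 f (x + t • v) ![v, v, v] with hq'
  have hder : ∀ t ∈ Set.Icc 0 T, HasDerivAt q (q' t) t := fun t ht =>
    hasDerivAt_hessian_line hf.isOpen_dom hf.contDiffOn (hD t ht)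
  have hbd : ∀ t ∈ Set.Icc 0 T, q' t ≤ M * q t * Real.sqrt (q t) ^ (ν - 2) * ‖v‖ ^ (3 - ν) := by
    intro t ht
    have h := (le_abs_self _).trans (hf.bound _ (hD t ht) v v)
    rw [localNorm_sq_of_pos (hpos t ht)] at h
    exact h
  have h0 : (0 : ℝ) ∈ Set.Icc 0 T := ⟨le_rfl, hT⟩
  have hTm : T ∈ Set.Icc 0 T := ⟨hT, le_rfl⟩
  have hq0 : 0 < q 0 := hpos 0 h0
  have he : localNorm f x v = Real.sqrt (q 0) := by simp [hq, localNorm]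
  rw [he] at hdom ⊢
  rw [Real.sq_sqrt hq0.le]
  change q T ≤ _
  rcases hν.1.eq_or_lt with rfl | h2
  · have h := nonneg_of_hasDerivAt_nonneg
      (F := fun t => Real.log (q 0) + t * (M * ‖v‖) - Real.log (q t))
      (F' := fun t => M * ‖v‖ - q' t / q t) hT (by simp)
      (fun t ht => by
        have h := (((hasDerivAt_id t).mul_const (M * ‖v‖)).const_add (Real.log (q 0))).sub
          ((hder t ht).log (hpos t ht).ne')
        rw [one_mul] at h
        exact h)
      (fun t ht => by
        have h := hbd t ht
        have hqt : 0 < q t := hpos t ht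
        norm_num at h
        rw [sub_nonneg, div_le_iff₀ hqt]
        linarith)
    have h' : Real.log (q T) ≤ Real.log (q 0) + T * (M * ‖v‖) := by linarith
    rw [rho, if_pos rfl, delta, if_pos rfl]
    calc q T = Real.exp (Real.log (q T)) := (Real.exp_log (hpos T hTm)).symm
      _ ≤ Real.exp (Real.log (q 0) + T * (M * ‖v‖)) := Real.exp_le_exp.2 h'
      _ = _ := by rw [Real.exp_add, Real.exp_log hq0]
  · have hr : 0 < (ν - 2) / 2 := by linarith
    have hsq : ∀ t ∈ Set.Icc 0 T, Real.sqrt (q t) ^ (ν - 2) = q t ^ ((ν - 2) / 2) := by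
      intro t ht
      rw [Real.sqrt_eq_rpow, ← Real.rpow_mul (hpos t ht).le]
      congr 1
      ring
    have h := nonneg_of_hasDerivAt_nonneg
      (F := fun t => q t ^ (-((ν - 2) / 2)) - q 0 ^ (-((ν - 2) / 2)) +
        t * ((ν - 2) / 2 * (M * ‖v‖ ^ (3 - ν))))
      (F' := fun t => q' t * (-((ν - 2) / 2)) * q t ^ (-((ν - 2) / 2) - 1) +
        (ν - 2) / 2 * (M * ‖v‖ ^ (3 - ν))) hT (by simp)
      (fun t ht => by
        have h := (((hder t ht).rpow_const (p := -((ν - 2) / 2))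
          (Or.inl (hpos t ht).ne')).sub_const (q 0 ^ (-((ν - 2) / 2)))).add
          ((hasDerivAt_id t).mul_const ((ν - 2) / 2 * (M * ‖v‖ ^ (3 - ν))))
        rw [one_mul] at h
        exact h)
      (fun t ht => by
        have h := hbd t ht
        have hqt : 0 < q t := hpos t ht
        rw [hsq t ht] at h
        have hw : 0 < q t ^ (-((ν - 2) / 2) - 1) := Real.rpow_pos_of_pos hqt _
        have e1 : q t * q t ^ ((ν - 2) / 2) * q t ^ (-((ν - 2) / 2) - 1) = 1 := by
          rw [mul_comm (q t), ← Real.rpow_add_one hqt.ne', ← Real.rpow_add hqt]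
          rw [show (ν - 2) / 2 + 1 + (-((ν - 2) / 2) - 1) = 0 by ring, Real.rpow_zero]
        have h3 : q' t * q t ^ (-((ν - 2) / 2) - 1) ≤ M * ‖v‖ ^ (3 - ν) := by
          calc _ ≤ M * q t * q t ^ ((ν - 2) / 2) * ‖v‖ ^ (3 - ν) * q t ^ (-((ν - 2) / 2) - 1) :=
                mul_le_mul_of_nonneg_right h hw.le
            _ = M * ‖v‖ ^ (3 - ν) *
                (q t * q t ^ ((ν - 2) / 2) * q t ^ (-((ν - 2) / 2) - 1)) := by ring
            _ = _ := by rw [e1, mul_one]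
        nlinarith)
    have ht1 : T * (M * delta ν ‖v‖ (Real.sqrt (q 0))) < 1 := hdom.resolve_left h2.ne'
    rw [rho, if_neg h2.ne']
    rw [delta, if_neg h2.ne', hsq 0 h0] at ht1 ⊢
    have hqT : 0 < q T := hpos T hTm
    have h4 : q 0 ^ (-((ν - 2) / 2)) *
        (1 - T * (M * ((ν - 2) / 2 * ‖v‖ ^ (3 - ν) * q 0 ^ ((ν - 2) / 2)))) ≤
        q T ^ (-((ν - 2) / 2)) := by
      have e1 : q 0 ^ (-((ν - 2) / 2)) * q 0 ^ ((ν - 2) / 2) = 1 := by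
        rw [← Real.rpow_add hq0, neg_add_cancel, Real.rpow_zero]
      have e2 : q 0 ^ (-((ν - 2) / 2)) *
        (1 - T * (M * ((ν - 2) / 2 * ‖v‖ ^ (3 - ν) * q 0 ^ ((ν - 2) / 2)))) =
          q 0 ^ (-((ν - 2) / 2)) - T * ((ν - 2) / 2 * (M * ‖v‖ ^ (3 - ν))) *
            (q 0 ^ (-((ν - 2) / 2)) * q 0 ^ ((ν - 2) / 2)) := by ring
      rw [e2, e1]
      linarith
    have hw0 : 0 < q 0 ^ (-((ν - 2) / 2)) := Real.rpow_pos_of_pos hq0 _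
    have h5 := Real.rpow_le_rpow_of_nonpos (z := -(2 / (ν - 2)))
      (mul_pos hw0 (by linarith)) h4 (neg_nonpos.2 (div_nonneg zero_le_two (by linarith)))
    have e3 : -((ν - 2) / 2) * -(2 / (ν - 2)) = 1 := by
      have : ν - 2 ≠ 0 := by linarith
      field_simp
    rw [Real.mul_rpow hw0.le (by linarith), ← Real.rpow_mul hqT.le, ← Real.rpow_mul hq0.le, e3,
      Real.rpow_one, Real.rpow_one] at h5
    exact h5

lemma le_upperModel_of_segment (hν : ν ∈ Set.Icc (2 : ℝ) 3) (hf : IsGSC D f M ν)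
    {x v : EuclideanSpace ℝ (Fin n)} {T : ℝ} (hT : 0 ≤ T)
    (ha : 0 < M * delta ν ‖v‖ (localNorm f x v)) (he : 0 < localNorm f x v)
    (hD : ∀ t ∈ Set.Icc 0 T, x + t • v ∈ D)
    (hpos : ∀ t ∈ Set.Icc 0 T, 0 < inner ℝ (hessian f (x + t • v) v) v)
    (hdom : InOmegaDom ν (T * (M * delta ν ‖v‖ (localNorm f x v)))) :
    f (x + T • v) ≤
      f x + upperModel M ν (-inner ℝ (gradient f x) v) ‖v‖ (localNorm f x v) T := by
  have hq : ∀ t ∈ Set.Icc 0 T, inner ℝ (hessian f (x + t • v) v) v ≤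
      localNorm f x v ^ 2 * rho ν (t * (M * delta ν ‖v‖ (localNorm f x v))) := fun t ht =>
    inner_hessian_line_le hν hf ht.1 (fun s hs => hD s ⟨hs.1, hs.2.trans ht.2⟩)
      (fun s hs => hpos s ⟨hs.1, hs.2.trans ht.2⟩)
      (hdom.mono (mul_le_mul_of_nonneg_right ht.2 ha.le))
  rw [upperModel_eq ha he]
  generalize M * delta ν ‖v‖ (localNorm f x v) = a at *
  generalize localNorm f x v = e at *
  have hlin (r : ℝ) : HasDerivAt (fun r => r * a) a r := by
    simpa using (hasDerivAt_id r).mul_const a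
  have hd : ∀ t ∈ Set.Icc 0 T, InOmegaDom ν (t * a) := fun t ht =>
    hdom.mono (mul_le_mul_of_nonneg_right ht.2 ha.le)
  have h1 : ∀ t ∈ Set.Icc 0 T, 0 ≤ e ^ 2 / a * psiDeriv ν (t * a) -
      (inner ℝ (gradient f (x + t • v)) v - inner ℝ (gradient f x) v) := fun t ht =>
    nonneg_of_hasDerivAt_nonneg
      (F := fun t => e ^ 2 / a * psiDeriv ν (t * a) -
        (inner ℝ (gradient f (x + t • v)) v - inner ℝ (gradient f x) v))
      (F' := fun t => e ^ 2 / a * (rho ν (t * a) * a) - inner ℝ (hessian f (x + t • v) v) v)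
      ht.1 (by simp [psiDeriv_zero])
      (fun s hs => by
        have hs' : s ∈ Set.Icc 0 T := ⟨hs.1, hs.2.trans ht.2⟩
        exact (((hasDerivAt_psiDeriv hν (hd s hs')).comp s (hlin s)).const_mul (e ^ 2 / a)).sub
          ((hasDerivAt_gradient_line hf.isOpen_dom hf.contDiffOn (hD s hs')).sub_const _))
      (fun s hs => by
        have h := hq s ⟨hs.1, hs.2.trans ht.2⟩
        have e1 : e ^ 2 / a * (rho ν (s * a) * a) = e ^ 2 * rho ν (s * a) := by field_simp
        rw [e1]
        linarith)
  have h2 := nonneg_of_hasDerivAt_nonneg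
    (F := fun t => e ^ 2 / a ^ 2 * psi ν (t * a) -
      (f (x + t • v) - f x - t * inner ℝ (gradient f x) v))
    (F' := fun t => e ^ 2 / a ^ 2 * (psiDeriv ν (t * a) * a) -
      (inner ℝ (gradient f (x + t • v)) v - inner ℝ (gradient f x) v))
    hT (by simp [psi_zero])
    (fun s hs => by
      have h := ((hasDerivAt_comp_line hf.isOpen_dom hf.contDiffOn (hD s hs)).sub_const (f x)).sub
        ((hasDerivAt_id s).mul_const (inner ℝ (gradient f x) v))
      rw [one_mul] at h
      exact (((hasDerivAt_psi hν (hd s hs)).comp s (hlin s)).const_mul (e ^ 2 / a ^ 2)).sub h)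
    (fun s hs => by
      have h := h1 s hs
      have e1 : e ^ 2 / a ^ 2 * (psiDeriv ν (s * a) * a) = e ^ 2 / a * psiDeriv ν (s * a) := by
        field_simp
      rwa [e1])
  have e3 : e ^ 2 / a ^ 2 * (psi ν (T * a) -
      a * -inner ℝ (gradient f x) v / e ^ 2 * (T * a)) =
      e ^ 2 / a ^ 2 * psi ν (T * a) + T * inner ℝ (gradient f x) v := by
    field_simp
    ring
  rw [e3]
  linarith

/-- Along a direction in which the model is finite, the function stays finite and lies below the
model. The bound by the model keeps the function bounded up to the boundary of the domain, which
therefore cannot be met, the epigraph being closed. -/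
lemma mem_and_le_upperModel (hν : ν ∈ Set.Icc (2 : ℝ) 3) (hf : IsGSC D f M ν)
    {x v : EuclideanSpace ℝ (Fin n)} {T : ℝ} (hT : 0 ≤ T) (hx : x ∈ D)
    (ha : 0 < M * delta ν ‖v‖ (localNorm f x v)) (he : 0 < localNorm f x v)
    (hpos : ∀ t ∈ Set.Icc 0 T, x + t • v ∈ D → 0 < inner ℝ (hessian f (x + t • v) v) v)
    (hdom : InOmegaDom ν (T * (M * delta ν ‖v‖ (localNorm f x v)))) :
    x + T • v ∈ D ∧ f (x + T • v) ≤
      f x + upperModel M ν (-inner ℝ (gradient f x) v) ‖v‖ (localNorm f x v) T := by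
  have hline : Continuous fun t : ℝ => x + t • v := by fun_prop
  have hseg : ∀ t : ℝ, 0 ≤ t → x + t • v ∈ D → ∀ s ∈ Set.Icc 0 t, x + s • v ∈ D := by
    intro t ht htD s hs
    rcases ht.eq_or_lt with rfl | ht
    · have : s = 0 := le_antisymm hs.2 hs.1
      simpa [this] using hx
    · have := hf.convex.1 hx htD
        (sub_nonneg.2 ((div_le_one ht).2 hs.2)) (div_nonneg hs.1 ht.le) (sub_add_cancel 1 (s / t))
      convert this using 1
      have e1 : s = s / t * t := by field_simp
      nth_rw 1 [e1]
      module
  have hsub : Set.Icc 0 T ⊆ {t | x + t • v ∈ D} := by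
    refine IsClosed.Icc_subset_of_forall_mem_nhdsWithin ?_ (by simpa using hx) ?_
    · set C := f x + (T * |inner ℝ (gradient f x) v| +
        localNorm f x v ^ 2 / (M * delta ν ‖v‖ (localNorm f x v)) ^ 2 *
          psi ν (T * (M * delta ν ‖v‖ (localNorm f x v)))) with hC
      have hset : {t | x + t • v ∈ D} ∩ Set.Icc 0 T =
          (fun t : ℝ => (x + t • v, C)) ⁻¹'
            {p : EuclideanSpace ℝ (Fin n) × ℝ | p.1 ∈ D ∧ f p.1 ≤ p.2} ∩ Set.Icc 0 T := by
        ext t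
        refine ⟨fun ⟨h1, h2⟩ => ⟨⟨h1, ?_⟩, h2⟩, fun ⟨h1, h2⟩ => ⟨h1.1, h2⟩⟩
        have htd : InOmegaDom ν (t * (M * delta ν ‖v‖ (localNorm f x v))) :=
          hdom.mono (mul_le_mul_of_nonneg_right h2.2 ha.le)
        refine (le_upperModel_of_segment hν hf h2.1 ha he (hseg t h2.1 h1)
          (fun s hs => hpos s ⟨hs.1, hs.2.trans h2.2⟩ (hseg t h2.1 h1 s hs)) htd).trans ?_
        rw [upperModel_eq ha he, hC]
        have hψ : psi ν (t * (M * delta ν ‖v‖ (localNorm f x v))) ≤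
            psi ν (T * (M * delta ν ‖v‖ (localNorm f x v))) := by
          have h0 : InOmegaDom ν 0 := hdom.mono (by positivity)
          refine ((convexOn_psi hν).le_max_of_mem_Icc h0 hdom
            ⟨mul_nonneg h2.1 ha.le, mul_le_mul_of_nonneg_right h2.2 ha.le⟩).trans ?_
          rw [psi_zero]
          exact max_le (psi_nonneg hν (by positivity) hdom) le_rfl
        have hin : t * inner ℝ (gradient f x) v ≤ T * |inner ℝ (gradient f x) v| :=
          (mul_le_mul_of_nonneg_left (le_abs_self _) h2.1).trans
            (mul_le_mul_of_nonneg_right h2.2 (abs_nonneg _))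
        generalize M * delta ν ‖v‖ (localNorm f x v) = a at *
        generalize localNorm f x v = e at *
        have e3 : e ^ 2 / a ^ 2 * (psi ν (t * a) -
            a * -inner ℝ (gradient f x) v / e ^ 2 * (t * a)) =
            e ^ 2 / a ^ 2 * psi ν (t * a) + t * inner ℝ (gradient f x) v := by
          field_simp
          ring
        rw [e3]
        have := mul_le_mul_of_nonneg_left hψ (show 0 ≤ e ^ 2 / a ^ 2 by positivity)
        linarith
      rw [hset]
      exact (hf.isClosed_epigraph.preimage (by fun_prop)).inter isClosed_Icc
    · intro t ht
      exact mem_nhdsWithin_of_mem_nhds ((hf.isOpen_dom.preimage hline).mem_nhds ht.1)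
  have hTm : T ∈ Set.Icc 0 T := ⟨hT, le_rfl⟩
  exact ⟨hsub hTm, le_upperModel_of_segment hν hf hT ha he (fun t ht => hsub ht)
    (fun t ht => hpos t ht (hsub ht)) hdom⟩

/-- A lower bound `σ` for the curvature along a segment gives the quadratic lower bound for the
function. -/
lemma quadratic_lower_bound (hD : IsOpen D) (hf : ContDiffOn ℝ 3 f D)
    {x v : EuclideanSpace ℝ (Fin n)} {σ : ℝ} (hseg : ∀ t ∈ Set.Icc (0 : ℝ) 1, x + t • v ∈ D)
    (hσ : ∀ t ∈ Set.Icc (0 : ℝ) 1, σ * ‖v‖ ^ 2 ≤ inner ℝ (hessian f (x + t • v) v) v) :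
    f x + inner ℝ (gradient f x) v + σ / 2 * ‖v‖ ^ 2 ≤ f (x + v) := by
  have h1 : ∀ t ∈ Set.Icc (0 : ℝ) 1, 0 ≤ inner ℝ (gradient f (x + t • v)) v -
      inner ℝ (gradient f x) v - t * (σ * ‖v‖ ^ 2) := fun t ht =>
    nonneg_of_hasDerivAt_nonneg
      (F := fun t => inner ℝ (gradient f (x + t • v)) v - inner ℝ (gradient f x) v -
        t * (σ * ‖v‖ ^ 2))
      (F' := fun t => inner ℝ (hessian f (x + t • v) v) v - 1 * (σ * ‖v‖ ^ 2)) ht.1 (by simp)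
      (fun s hs => ((hasDerivAt_gradient_line hD hf
        (hseg s ⟨hs.1, hs.2.trans ht.2⟩)).sub_const _).sub ((hasDerivAt_id s).mul_const _))
      (fun s hs => by
        have := hσ s ⟨hs.1, hs.2.trans ht.2⟩
        linarith)
  have h2 := nonneg_of_hasDerivAt_nonneg
      (F := fun t => f (x + t • v) - f x - t * inner ℝ (gradient f x) v -
        t ^ 2 * (σ / 2 * ‖v‖ ^ 2))
      (F' := fun t => inner ℝ (gradient f (x + t • v)) v - 1 * inner ℝ (gradient f x) v -
        (2 * t) * (σ / 2 * ‖v‖ ^ 2)) zero_le_one (by simp)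
      (fun s hs => (((hasDerivAt_comp_line hD hf (hseg s hs)).sub_const _).sub
        ((hasDerivAt_id s).mul_const _)).sub
        (by simpa using (hasDerivAt_pow 2 s).mul_const (σ / 2 * ‖v‖ ^ 2)))
      (fun s hs => by
        have := h1 s hs
        linarith)
  simp only [one_smul] at h2
  linarith

end Descent

/-! ### Geometry of the polytope -/

section Polytope

variable {m n : ℕ} {B : Matrix (Fin m) (Fin n) ℝ} {b : Fin m → ℝ}

lemma mulVec_eq_inner (B : Matrix (Fin m) (Fin n) ℝ) (i : Fin m) (z : EuclideanSpace ℝ (Fin n)) :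
    (B *ᵥ z.ofLp) i = inner ℝ (WithLp.toLp 2 (B i)) z := by
  rw [EuclideanSpace.inner_eq_star_dotProduct]
  simp [Matrix.mulVec, dotProduct_comm]

lemma mem_polytope {z : EuclideanSpace ℝ (Fin n)} :
    z ∈ polytope B b ↔ ∀ i, inner ℝ (WithLp.toLp 2 (B i)) z ≤ b i := by
  simp only [polytope, Set.mem_ofPred_eq, mulVec_eq_inner]

lemma convex_polytope : Convex ℝ (polytope B b) := by
  intro x hx y hy s t hs ht hst
  rw [mem_polytope] at hx hy ⊢
  intro i
  rw [inner_add_right, real_inner_smul_right, real_inner_smul_right]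
  have h1 := mul_le_mul_of_nonneg_left (hx i) hs
  have h2 := mul_le_mul_of_nonneg_left (hy i) ht
  have h3 : s * b i + t * b i = b i := by rw [← add_mul, hst, one_mul]
  linarith

/-- A vertex is determined by the constraints that bind at it. -/
lemma finite_vertices : (vertices B b).Finite := by
  classical
  refine Set.Finite.of_injOn (f := fun u : EuclideanSpace ℝ (Fin n) =>
    (Finset.univ.filter fun i => inner ℝ (WithLp.toLp 2 (B i)) u = b i : Finset (Fin m)))
    (t := Set.univ) (fun _ _ => Set.mem_univ _) ?_ Set.finite_univ
  intro u hu v hv huv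
  have hiff : ∀ i, inner ℝ (WithLp.toLp 2 (B i)) u = b i ↔
      inner ℝ (WithLp.toLp 2 (B i)) v = b i := fun i => by
    simpa using congrArg (fun s => i ∈ s) huv
  have huX := mem_polytope.1 hu.1
  -- `u` may be moved a little away from `v` without leaving the polytope
  have hev : ∀ i, ∀ᶠ ε : ℝ in nhdsWithin 0 (Set.Ioi 0),
      inner ℝ (WithLp.toLp 2 (B i)) (u + ε • (u - v)) ≤ b i := by
    intro i
    by_cases hi : inner ℝ (WithLp.toLp 2 (B i)) u = b i
    · refine Filter.Eventually.of_forall fun ε => ?_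
      rw [inner_add_right, real_inner_smul_right, inner_sub_right, hi, (hiff i).1 hi]
      simp
    · have hlt := lt_of_le_of_ne (huX i) hi
      have hc : ContinuousAt
          (fun ε : ℝ => inner ℝ (WithLp.toLp 2 (B i)) (u + ε • (u - v))) 0 := by fun_prop
      have h0 : inner ℝ (WithLp.toLp 2 (B i)) (u + (0 : ℝ) • (u - v)) < b i := by simpa using hlt
      exact ((hc.eventually (gt_mem_nhds h0)).filter_mono nhdsWithin_le_nhds).mono
        fun ε h => le_of_lt h
  obtain ⟨ε, hε, hε0⟩ := ((Filter.eventually_all.2 hev).and self_mem_nhdsWithin).exists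
  have hε0 : 0 < ε := hε0
  have hmem : u + ε • (u - v) ∈ polytope B b := mem_polytope.2 hε
  have hseg : u ∈ openSegment ℝ v (u + ε • (u - v)) := by
    refine ⟨ε / (1 + ε), 1 / (1 + ε), by positivity, by positivity, by field_simp; ring, ?_⟩
    have h1 : u = (1 + ε)⁻¹ • ((1 + ε) • u) := by
      rw [smul_smul, inv_mul_cancel₀ (by positivity), one_smul]
    rw [div_eq_inv_mul, div_eq_inv_mul, mul_one, mul_smul]
    nth_rw 3 [h1]
    rw [← smul_add]
    congr 1
    module
  exact (hu.2 hv.1 hmem hseg).symm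

/-- A nonempty compact polytope has no nonzero recession directions. -/
lemma eq_zero_of_recession (hX : IsCompact (polytope B b)) {y w : EuclideanSpace ℝ (Fin n)}
    (hy : y ∈ polytope B b) (hw : ∀ i, inner ℝ (WithLp.toLp 2 (B i)) w ≤ 0) : w = 0 := by
  obtain ⟨R, hR⟩ := hX.isBounded.subset_closedBall y
  have hmem : ∀ t : ℝ, 0 ≤ t → t * ‖w‖ ≤ R := by
    intro t ht
    have h1 : y + t • w ∈ polytope B b := by
      rw [mem_polytope] at hy ⊢
      intro i
      rw [inner_add_right, real_inner_smul_right]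
      have := mul_nonneg_of_nonpos_of_nonpos (neg_nonpos.2 ht) (hw i)
      linarith [hy i]
    have h2 := hR h1
    rwa [Metric.mem_closedBall, dist_eq_norm, add_sub_cancel_left, norm_smul, Real.norm_eq_abs,
      abs_of_nonneg ht] at h2
  by_contra hne
  have hpos : 0 < ‖w‖ := norm_pos_iff.2 hne
  have hR0 : 0 ≤ R := by simpa using hmem 0 le_rfl
  have := hmem ((R + 1) / ‖w‖) (by positivity)
  rw [div_mul_cancel₀ _ hpos.ne'] at this
  linarith

lemma exists_not_binding (hX : IsCompact (polytope B b)) (hnt : (polytope B b).Nontrivial) :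
    ∃ i, i ∉ binding B b (vertices B b) ∧ WithLp.toLp 2 (B i) ≠ 0 := by
  by_contra! hcon
  have hV : (vertices B b).Nontrivial := by
    by_contra hV
    rw [Set.not_nontrivial_iff] at hV
    have h1 := closure_convexHull_extremePoints hX convex_polytope
    rcases hV.eq_empty_or_singleton with h | ⟨x, h⟩
    · rw [show (polytope B b).extremePoints ℝ = ∅ from h] at h1
      simp only [convexHull_empty, closure_empty] at h1
      rw [← h1] at hnt
      exact Set.not_nontrivial_empty hnt
    · rw [show (polytope B b).extremePoints ℝ = {x} from h] at h1
      simp only [convexHull_singleton, closure_singleton] at h1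
      rw [← h1] at hnt
      exact Set.not_nontrivial_singleton hnt
  obtain ⟨x, hx, y, hy, hxy⟩ := hV
  refine hxy (sub_eq_zero.1 (eq_zero_of_recession hX hx.1 (w := x - y) fun i => ?_))
  by_cases hi : i ∈ binding B b (vertices B b)
  · have h1 := hi x hx
    have h2 := hi y hy
    rw [mulVec_eq_inner] at h1 h2
    rw [inner_sub_right, h1, h2, sub_self]
  · rw [hcon i hi, inner_zero_left]

lemma notMem_binding_iff {i : Fin m} :
    i ∉ binding B b (vertices B b) ↔ ∃ u ∈ vertices B b, (B *ᵥ u.ofLp) i < b i := by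
  constructor
  · intro h
    simp only [binding, Set.mem_ofPred_eq, not_forall] at h
    obtain ⟨u, hu, hne⟩ := h
    exact ⟨u, hu, lt_of_le_of_ne (hu.1 i) hne⟩
  · rintro ⟨u, hu, hlt⟩ h
    exact hlt.ne (h u hu)

lemma finite_slacks :
    {r | ∃ u ∈ vertices B b, ∃ i, (B *ᵥ u.ofLp) i < b i ∧ r = b i - (B *ᵥ u.ofLp) i}.Finite := by
  refine ((finite_vertices (B := B) (b := b)).prod (Set.finite_univ (α := Fin m))).image
    (fun p => b p.2 - (B *ᵥ p.1.ofLp) p.2) |>.subset ?_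
  rintro r ⟨u, hu, i, -, rfl⟩
  exact ⟨(u, i), ⟨hu, Set.mem_univ i⟩, rfl⟩

lemma zeta_le {u : EuclideanSpace ℝ (Fin n)} (hu : u ∈ vertices B b) {i : Fin m}
    (hi : (B *ᵥ u.ofLp) i < b i) : zeta B b ≤ b i - (B *ᵥ u.ofLp) i :=
  csInf_le finite_slacks.bddBelow ⟨u, hu, i, hi, rfl⟩

lemma zeta_pos (hX : IsCompact (polytope B b)) (hnt : (polytope B b).Nontrivial) :
    0 < zeta B b := by
  obtain ⟨i, hi, -⟩ := exists_not_binding hX hnt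
  obtain ⟨u, hu, hlt⟩ := notMem_binding_iff.1 hi
  have hne : {r | ∃ u ∈ vertices B b, ∃ i, (B *ᵥ u.ofLp) i < b i ∧
      r = b i - (B *ᵥ u.ofLp) i}.Nonempty := ⟨_, u, hu, i, hlt, rfl⟩
  obtain ⟨_, _, _, h, h'⟩ := hne.csInf_mem finite_slacks
  rw [zeta, h']
  linarith

lemma norm_row_le_phi {i : Fin m} (hi : i ∉ binding B b (vertices B b)) :
    ‖WithLp.toLp 2 (B i)‖ ≤ phi B b := by
  refine le_csSup (Set.Finite.bddAbove ?_) ⟨i, hi, rfl⟩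
  refine (Set.finite_range fun i => ‖WithLp.toLp 2 (B i)‖).subset ?_
  rintro r ⟨j, -, rfl⟩
  exact ⟨j, rfl⟩

lemma phi_pos (hX : IsCompact (polytope B b)) (hnt : (polytope B b).Nontrivial) :
    0 < phi B b := by
  obtain ⟨i, hi, hne⟩ := exists_not_binding hX hnt
  exact (norm_pos_iff.2 hne).trans_le (norm_row_le_phi hi)

lemma ncard_vertices_pos (hX : IsCompact (polytope B b)) (hnt : (polytope B b).Nontrivial) :
    0 < (vertices B b).ncard := by
  obtain ⟨i, hi, -⟩ := exists_not_binding hX hnt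
  obtain ⟨u, hu, -⟩ := notMem_binding_iff.1 hi
  exact (Set.ncard_pos finite_vertices).2 ⟨u, hu⟩

lemma Omega_pos (hX : IsCompact (polytope B b)) (hnt : (polytope B b).Nontrivial) :
    0 < Omega B b :=
  div_pos (div_pos (zeta_pos hX hnt) (phi_pos hX hnt))
    (Nat.cast_pos.2 (ncard_vertices_pos hX hnt))

lemma IsVertexRep.mem_polytope {x : EuclideanSpace ℝ (Fin n)} {μ : EuclideanSpace ℝ (Fin n) →₀ ℝ}
    (h : IsVertexRep B b x μ) : x ∈ polytope B b := by
  rw [← h.2.2.2]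
  exact convex_polytope.sum_mem (fun u _ => h.2.1 u) h.2.2.1 (fun u hu => (h.1 u hu).1)

/-- Given a point with barycentric weights `μ` and a point `y` of the polytope, the weights can be
lowered to `w ≤ μ` such that the `w`-weighted sum of the slacks `S i` stays below the slack `S i y`
for every constraint `i`, while each lowered vertex has positive slack in a constraint for which
equality holds. The weights of maximal total mass have this property. -/
lemma exists_maximal_weights (U : Finset (EuclideanSpace ℝ (Fin n)))
    {μ : EuclideanSpace ℝ (Fin n) → ℝ} (hμ : ∀ u, 0 ≤ μ u)
    {S : Fin m → EuclideanSpace ℝ (Fin n) → ℝ} (hS : ∀ i, ∀ u ∈ U, 0 ≤ S i u)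
    {y : EuclideanSpace ℝ (Fin n)} (hy : ∀ i, 0 ≤ S i y) :
    ∃ w : U → ℝ, (∀ u, 0 ≤ w u) ∧ (∀ u, w u ≤ μ u) ∧ (∀ i, ∑ u, w u * S i u ≤ S i y) ∧
      ∀ u, w u < μ u → ∃ i, 0 < S i u ∧ ∑ u, w u * S i u = S i y := by
  classical
  set K : Set (U → ℝ) := Set.Icc 0 (fun u => μ u) ∩ {w | ∀ i, ∑ u, w u * S i u ≤ S i y} with hK
  have hKc : IsCompact K := by
    refine isCompact_Icc.inter_right ?_
    rw [Set.ofPred_forall]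
    exact isClosed_iInter fun i => isClosed_le (by fun_prop) continuous_const
  have hKn : K.Nonempty := ⟨0, ⟨le_rfl, fun u => hμ u⟩, fun i => by simpa using hy i⟩
  obtain ⟨w, hwK, hmax⟩ := hKc.exists_isMaxOn hKn
    (f := fun w : U → ℝ => ∑ u, w u) (by fun_prop)
  refine ⟨w, hwK.1.1, hwK.1.2, hwK.2, fun u hu => ?_⟩
  by_contra! hcon
  have hsum (i : Fin m) (ε : ℝ) : ∑ v, (w + Pi.single u ε : U → ℝ) v * S i v =
      ∑ v, w v * S i v + ε * S i u := by
    simp [add_mul, Finset.sum_add_distrib, Pi.single_apply]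
  have hev : ∀ i, ∀ᶠ ε : ℝ in nhdsWithin 0 (Set.Ioi 0),
      ∑ v, w v * S i v + ε * S i u ≤ S i y := by
    intro i
    rcases (hS i u u.2).eq_or_lt with h | h
    · refine Filter.Eventually.of_forall fun ε => ?_
      simpa [← h] using hwK.2 i
    · have hlt := lt_of_le_of_ne (hwK.2 i) (hcon i h)
      have hc : ContinuousAt (fun ε : ℝ => ∑ v, w v * S i v + ε * S i u) 0 := by fun_prop
      have h0 : ∑ v, w v * S i v + 0 * S i u < S i y := by simpa using hlt
      exact ((hc.eventually (gt_mem_nhds h0)).filter_mono nhdsWithin_le_nhds).mono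
        fun ε h => le_of_lt h
  have hev' : ∀ᶠ ε : ℝ in nhdsWithin 0 (Set.Ioi 0), ε < μ u - w u :=
    (gt_mem_nhds (sub_pos.2 hu)).filter_mono nhdsWithin_le_nhds
  obtain ⟨ε, ⟨hε, hε1⟩, hε0⟩ :=
    (((Filter.eventually_all.2 hev).and hev').and self_mem_nhdsWithin).exists
  have hε0 : 0 < ε := hε0
  have hmem : w + Pi.single u ε ∈ K := by
    refine ⟨⟨add_nonneg hwK.1.1 (Pi.single_nonneg.2 hε0.le), fun v => ?_⟩, fun i => ?_⟩
    · by_cases hv : v = u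
      · subst hv
        simp only [Pi.add_apply, Pi.single_eq_same]
        linarith
      · simpa [Pi.single_eq_of_ne hv] using hwK.1.2 v
    · rw [hsum]
      exact hε i
  have h1 := hmax hmem
  simp only [Set.mem_ofPred_eq, Pi.add_apply, Finset.sum_add_distrib,
    Finset.sum_pi_single', Finset.mem_univ, if_true] at h1
  linarith

/-- The vertex-facet distance controls the gap between the largest value of a linear form on the
active vertices of `x` and its least value on the polytope: it is at least `Ω` times the slope of
the form between `x` and any other point `y`. With the weights `w` of `exists_maximal_weights`, the
lowered mass `Λ` is at most `‖x - y‖ / Ω`, since each lowered vertex has slack at least `ζ` in a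
constraint whose slack differs by at most `φ ‖x - y‖` between `x` and `y`; and `y` arises from `x`
by moving mass `Λ` from active vertices to a point of the polytope. -/
lemma Omega_mul_inner_le (hX : IsCompact (polytope B b)) (hnt : (polytope B b).Nontrivial)
    {x y c s u : EuclideanSpace ℝ (Fin n)} {μ : EuclideanSpace ℝ (Fin n) →₀ ℝ}
    (hμ : IsVertexRep B b x μ) (hy : y ∈ polytope B b)
    (hs : ∀ z ∈ polytope B b, inner ℝ c s ≤ inner ℝ c z) (hu : u ∈ μ.support)
    (humax : ∀ w ∈ μ.support, inner ℝ c w ≤ inner ℝ c u) :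
    Omega B b * inner ℝ c (x - y) ≤ ‖x - y‖ * inner ℝ c (u - s) := by
  classical
  have hyX := mem_polytope.1 hy
  have hvX : ∀ v ∈ μ.support, ∀ i, inner ℝ (WithLp.toLp 2 (B i)) v ≤ b i := fun v hv =>
    mem_polytope.1 (hμ.1 v hv).1
  obtain ⟨w, hw0, hwμ, hwS, hwtight⟩ := exists_maximal_weights (m := m) μ.support hμ.2.1
    (S := fun i v => b i - inner ℝ (WithLp.toLp 2 (B i)) v) (y := y)
    (fun i v hv => sub_nonneg.2 (hvX v hv i)) (fun i => sub_nonneg.2 (hyX i))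
  have hsum1 : ∑ v : μ.support, μ v = 1 := by
    rw [Finset.sum_coe_sort μ.support (fun v => μ v)]; exact hμ.2.2.1
  have hsumx : ∑ v : μ.support, μ v • (v : EuclideanSpace ℝ (Fin n)) = x := by
    rw [Finset.sum_coe_sort μ.support (fun v => μ v • v)]; exact hμ.2.2.2
  have hζ := zeta_pos hX hnt
  have hφ := phi_pos hX hnt
  set Λ := ∑ v : μ.support, (μ v - w v) with hΛ
  have hΛ0 : 0 ≤ Λ := Finset.sum_nonneg fun v _ => sub_nonneg.2 (hwμ v)
  have hslackx : ∀ i, ∑ v : μ.support, μ v * (b i - inner ℝ (WithLp.toLp 2 (B i)) v) =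
      b i - inner ℝ (WithLp.toLp 2 (B i)) x := by
    intro i
    simp_rw [mul_sub, Finset.sum_sub_distrib, ← Finset.sum_mul, hsum1, one_mul]
    rw [← hsumx, inner_sum]
    simp_rw [real_inner_smul_right]
  have hlam : ∀ v : μ.support, (μ v - w v) * zeta B b ≤ phi B b * ‖x - y‖ := by
    intro v
    rcases (hwμ v).eq_or_lt with h | h
    · rw [h, sub_self, zero_mul]
      positivity
    · obtain ⟨i, hi, htight⟩ := hwtight v h
      have hvV := hμ.1 v v.2
      have hi' : (B *ᵥ (v : EuclideanSpace ℝ (Fin n)).ofLp) i < b i := by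
        rw [mulVec_eq_inner]; linarith
      have h1 := zeta_le hvV hi'
      rw [mulVec_eq_inner] at h1
      have h2 : (μ v - w v) * (b i - inner ℝ (WithLp.toLp 2 (B i)) v) ≤
          ∑ v : μ.support, (μ v - w v) * (b i - inner ℝ (WithLp.toLp 2 (B i)) v) :=
        Finset.single_le_sum (f := fun v : μ.support =>
          (μ v - w v) * (b i - inner ℝ (WithLp.toLp 2 (B i)) (v : EuclideanSpace ℝ (Fin n))))
          (fun v _ => mul_nonneg (sub_nonneg.2 (hwμ v)) (sub_nonneg.2 (hvX v v.2 i)))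
          (Finset.mem_univ v)
      have h3 : ∑ v : μ.support, (μ v - w v) * (b i - inner ℝ (WithLp.toLp 2 (B i)) v) =
          inner ℝ (WithLp.toLp 2 (B i)) (y - x) := by
        simp_rw [sub_mul _ _ (b i - _), Finset.sum_sub_distrib]
        rw [hslackx, htight, inner_sub_right]
        ring
      have h4 : inner ℝ (WithLp.toLp 2 (B i)) (y - x) ≤ phi B b * ‖x - y‖ := by
        refine (real_inner_le_norm _ _).trans ?_
        rw [norm_sub_rev]
        exact mul_le_mul_of_nonneg_right
          (norm_row_le_phi (notMem_binding_iff.2 ⟨v, hvV, hi'⟩)) (norm_nonneg _)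
      have h5 := mul_le_mul_of_nonneg_left h1 (sub_nonneg.2 (hwμ v))
      linarith
  have hcard : (μ.support.card : ℝ) ≤ (vertices B b).ncard := by
    rw [← Set.ncard_coe_finset]
    exact_mod_cast Set.ncard_le_ncard (fun v hv => hμ.1 v hv) finite_vertices
  have hN : (0 : ℝ) < (vertices B b).ncard := Nat.cast_pos.2 (ncard_vertices_pos hX hnt)
  have hΛle : Omega B b * Λ ≤ ‖x - y‖ := by
    have h1 : Λ * zeta B b ≤ (vertices B b).ncard * (phi B b * ‖x - y‖) := by
      rw [hΛ, Finset.sum_mul]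
      refine (Finset.sum_le_sum fun v _ => hlam v).trans ?_
      rw [Finset.sum_const, nsmul_eq_mul, Finset.card_univ, Fintype.card_coe]
      exact mul_le_mul_of_nonneg_right hcard (by positivity)
    rw [Omega, vertexFacetDist, div_div, div_mul_eq_mul_div, div_le_iff₀ (by positivity)]
    linarith
  set z := y - ∑ v : μ.support, w v • (v : EuclideanSpace ℝ (Fin n)) with hz
  have hΛw : Λ = 1 - ∑ v, w v := by rw [hΛ, Finset.sum_sub_distrib, hsum1]
  have hzB : ∀ i, inner ℝ (WithLp.toLp 2 (B i)) z ≤ Λ * b i := by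
    intro i
    have h := hwS i
    simp_rw [mul_sub, Finset.sum_sub_distrib, ← Finset.sum_mul] at h
    rw [hz, inner_sub_right, inner_sum, hΛw]
    simp_rw [real_inner_smul_right]
    linarith
  have hzs : Λ * inner ℝ c s ≤ inner ℝ c z := by
    rcases hΛ0.eq_or_lt with h | h
    · have : z = 0 := eq_zero_of_recession hX hy (fun i => by simpa [← h] using hzB i)
      rw [← h, this]
      simp
    · have hp : Λ⁻¹ • z ∈ polytope B b := by
        rw [mem_polytope]
        intro i
        rw [real_inner_smul_right, inv_mul_le_iff₀ h]
        exact hzB i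
      have := hs _ hp
      rw [real_inner_smul_right] at this
      rwa [← le_inv_mul_iff₀ h]
  have hmove : inner ℝ c (x - y) ≤ Λ * inner ℝ c (u - s) := by
    have h1 : x - y = ∑ v : μ.support, (μ v - w v) • (v : EuclideanSpace ℝ (Fin n)) - z := by
      simp_rw [sub_smul, Finset.sum_sub_distrib]
      rw [hsumx, hz]
      abel
    clear_value z
    rw [h1, inner_sub_right, inner_sum, inner_sub_right]
    simp_rw [real_inner_smul_right]
    have h2 : ∑ v : μ.support, (μ v - w v) * inner ℝ c (v : EuclideanSpace ℝ (Fin n)) ≤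
        Λ * inner ℝ c u := by
      rw [hΛ, Finset.sum_mul]
      exact Finset.sum_le_sum fun v _ =>
        mul_le_mul_of_nonneg_left (humax v v.2) (sub_nonneg.2 (hwμ v))
    linarith
  have hgap : 0 ≤ inner ℝ c (u - s) := by
    rw [inner_sub_right]
    exact sub_nonneg.2 (hs u (hμ.1 u hu).1)
  calc Omega B b * inner ℝ c (x - y) ≤ Omega B b * (Λ * inner ℝ c (u - s)) :=
        mul_le_mul_of_nonneg_left hmove (Omega_pos hX hnt).le
    _ = Omega B b * Λ * inner ℝ c (u - s) := by ring
    _ ≤ _ := mul_le_mul_of_nonneg_right hΛle hgap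

end Polytope

/-! ### Curvature on the level set -/

section LevelSet

variable {n : ℕ} {D X : Set (EuclideanSpace ℝ (Fin n))} {f : EuclideanSpace ℝ (Fin n) → ℝ} {M ν : ℝ}
  {x₀ : EuclideanSpace ℝ (Fin n)}

lemma isCompact_levelSet (hf : IsGSC D f M ν) (hX : IsCompact X) :
    IsCompact (levelSet D X f x₀) := by
  have h : levelSet D X f x₀ = X ∩ (fun x => (x, f x₀)) ⁻¹'
      {p : EuclideanSpace ℝ (Fin n) × ℝ | p.1 ∈ D ∧ f p.1 ≤ p.2} := by
    ext x
    exact and_assoc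
  rw [h]
  exact hX.inter_right (hf.isClosed_epigraph.preimage (by fun_prop))

lemma convex_levelSet (hf : IsGSC D f M ν) (hX : Convex ℝ X) :
    Convex ℝ (levelSet D X f x₀) := by
  have h : levelSet D X f x₀ = X ∩ {x ∈ D | f x ≤ f x₀} := by
    ext x
    exact and_assoc
  rw [h]
  exact hX.inter (hf.convex.convex_le _)

lemma continuousOn_hessian (hf : IsGSC D f M ν) : ContinuousOn (hessian f) D := fun _ hx =>
  (contDiffAt_hessian hf.isOpen_dom hf.contDiffOn hx).continuousAt.continuousWithinAt

lemma exists_norm_hessian_le (hf : IsGSC D f M ν) (hX : IsCompact X) :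
    ∃ C, ∀ x ∈ levelSet D X f x₀, ‖hessian f x‖ ≤ C :=
  (isCompact_levelSet hf hX).exists_bound_of_continuousOn
    ((continuousOn_hessian hf).mono fun _ hx => hx.1.2)

/-- An eigenvalue is the value of the quadratic form at a unit vector. -/
lemma exists_unit_of_mem_hessianEigenvalues {S : Set (EuclideanSpace ℝ (Fin n))} {r : ℝ}
    (hr : r ∈ hessianEigenvalues f S) :
    ∃ x ∈ S, ∃ v : EuclideanSpace ℝ (Fin n), ‖v‖ = 1 ∧ inner ℝ (hessian f x v) v = r := by
  obtain ⟨x, hx, hr⟩ := hr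
  obtain ⟨v, hv⟩ := hr.exists_hasEigenvector
  have hv0 : ‖v‖ ≠ 0 := norm_ne_zero_iff.2 hv.2
  have hHv : hessian f x v = r • v := hv.apply_eq_smul
  refine ⟨x, hx, ‖v‖⁻¹ • v, ?_, ?_⟩
  · rw [norm_smul, norm_inv, norm_norm, inv_mul_cancel₀ hv0]
  · rw [map_smul, hHv, real_inner_smul_left, real_inner_smul_right, real_inner_smul_left,
      real_inner_self_eq_norm_sq]
    field_simp

lemma abs_inner_hessian_le (x v : EuclideanSpace ℝ (Fin n)) :
    |inner ℝ (hessian f x v) v| ≤ ‖hessian f x‖ * ‖v‖ ^ 2 := by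
  refine (abs_real_inner_le_norm _ _).trans ?_
  rw [pow_two, ← mul_assoc]
  exact mul_le_mul_of_nonneg_right ((hessian f x).le_opNorm v) (norm_nonneg v)

lemma bddAbove_hessianEigenvalues (hf : IsGSC D f M ν) (hX : IsCompact X) :
    BddAbove (hessianEigenvalues f (levelSet D X f x₀)) := by
  obtain ⟨C, hC⟩ := exists_norm_hessian_le (x₀ := x₀) hf hX
  refine ⟨C, fun r hr => ?_⟩
  obtain ⟨x, hx, v, hv, rfl⟩ := exists_unit_of_mem_hessianEigenvalues hr
  have h := (le_abs_self _).trans (abs_inner_hessian_le (f := f) x v)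
  rw [hv, one_pow, mul_one] at h
  exact h.trans (hC x hx)

lemma bddBelow_hessianEigenvalues (hf : IsGSC D f M ν) (hX : IsCompact X) :
    BddBelow (hessianEigenvalues f (levelSet D X f x₀)) := by
  obtain ⟨C, hC⟩ := exists_norm_hessian_le (x₀ := x₀) hf hX
  refine ⟨-C, fun r hr => ?_⟩
  obtain ⟨x, hx, v, hv, rfl⟩ := exists_unit_of_mem_hessianEigenvalues hr
  have h := (neg_le_abs _).trans (abs_inner_hessian_le (f := f) x v)
  rw [hv, one_pow, mul_one] at h
  linarith [hC x hx]

lemma inner_hessian_le_maxCurv (hf : IsGSC D f M ν) (hX : IsCompact X)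
    {x : EuclideanSpace ℝ (Fin n)} (hx : x ∈ levelSet D X f x₀) (v : EuclideanSpace ℝ (Fin n)) :
    inner ℝ (hessian f x v) v ≤ maxCurv f (levelSet D X f x₀) * ‖v‖ ^ 2 := by
  rcases eq_or_ne v 0 with rfl | hv
  · simp
  have : Nontrivial (EuclideanSpace ℝ (Fin n)) := ⟨v, 0, hv⟩
  have h := (hessian_isSymmetric hf.isOpen_dom
    hf.contDiffOn hx.1.2).hasEigenvalue_iSup_of_finiteDimensional
  have h1 := le_csSup (bddAbove_hessianEigenvalues hf hX) ⟨x, hx, h⟩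
  have hbdd : BddAbove (Set.range fun w : {w : EuclideanSpace ℝ (Fin n) // w ≠ 0} =>
      RCLike.re (inner ℝ (hessian f x w) (w : EuclideanSpace ℝ (Fin n))) /
        ‖(w : EuclideanSpace ℝ (Fin n))‖ ^ 2) := by
    refine ⟨‖hessian f x‖, ?_⟩
    rintro _ ⟨w, rfl⟩
    have hw := norm_pos_iff.2 w.2
    exact (div_le_iff₀ (by positivity)).2 ((le_abs_self _).trans (abs_inner_hessian_le x w))
  have h2 := (le_ciSup hbdd ⟨v, hv⟩).trans h1
  have hv' := norm_pos_iff.2 hv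
  exact (div_le_iff₀ (by positivity)).1 h2

lemma minCurv_le_inner_hessian (hf : IsGSC D f M ν) (hX : IsCompact X)
    {x : EuclideanSpace ℝ (Fin n)} (hx : x ∈ levelSet D X f x₀) (v : EuclideanSpace ℝ (Fin n)) :
    minCurv f (levelSet D X f x₀) * ‖v‖ ^ 2 ≤ inner ℝ (hessian f x v) v := by
  rcases eq_or_ne v 0 with rfl | hv
  · simp
  have : Nontrivial (EuclideanSpace ℝ (Fin n)) := ⟨v, 0, hv⟩
  have h := (hessian_isSymmetric hf.isOpen_dom
    hf.contDiffOn hx.1.2).hasEigenvalue_iInf_of_finiteDimensional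
  have h1 := csInf_le (bddBelow_hessianEigenvalues hf hX) ⟨x, hx, h⟩
  have hbdd : BddBelow (Set.range fun w : {w : EuclideanSpace ℝ (Fin n) // w ≠ 0} =>
      RCLike.re (inner ℝ (hessian f x w) (w : EuclideanSpace ℝ (Fin n))) /
        ‖(w : EuclideanSpace ℝ (Fin n))‖ ^ 2) := by
    refine ⟨-‖hessian f x‖, ?_⟩
    rintro _ ⟨w, rfl⟩
    have hw := norm_pos_iff.2 w.2
    refine (le_div_iff₀ (by positivity)).2 ?_
    have := (neg_le_abs _).trans (abs_inner_hessian_le (f := f) x w)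
    rw [neg_mul]
    exact neg_le.1 this
  have h2 := h1.trans (ciInf_le hbdd ⟨v, hv⟩)
  have hv' := norm_pos_iff.2 hv
  exact (le_div_iff₀ (by positivity)).1 h2

lemma minCurv_pos [Nontrivial (EuclideanSpace ℝ (Fin n))] (hf : IsGSC D f M ν) (hX : IsCompact X)
    (hpd : ∀ y ∈ X ∩ D, ∀ v : EuclideanSpace ℝ (Fin n), v ≠ 0 → 0 < inner ℝ (hessian f y v) v)
    (hne : (levelSet D X f x₀).Nonempty) : 0 < minCurv f (levelSet D X f x₀) := by
  set K := levelSet D X f x₀ ×ˢ Metric.sphere (0 : EuclideanSpace ℝ (Fin n)) 1 with hK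
  have hKc : IsCompact K := (isCompact_levelSet hf hX).prod (isCompact_sphere _ _)
  have hKn : K.Nonempty := hne.prod (NormedSpace.sphere_nonempty.2 zero_le_one)
  have hc : ContinuousOn (fun p : EuclideanSpace ℝ (Fin n) × EuclideanSpace ℝ (Fin n) =>
      inner ℝ (hessian f p.1 p.2) p.2) K := by
    have h1 : ContinuousOn (fun p : EuclideanSpace ℝ (Fin n) × EuclideanSpace ℝ (Fin n) =>
        hessian f p.1) K :=
      (continuousOn_hessian hf).comp continuousOn_fst fun p hp => hp.1.1.2
    exact (h1.clm_apply continuousOn_snd).inner continuousOn_snd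
  obtain ⟨p, hp, hmin⟩ := hKc.exists_isMinOn hKn hc
  have hp2 : p.2 ≠ 0 := by
    have := hp.2
    rw [mem_sphere_zero_iff_norm] at this
    exact norm_ne_zero_iff.1 (by rw [this]; exact one_ne_zero)
  refine (hpd p.1 hp.1.1 p.2 hp2).trans_le (le_csInf ?_ fun r hr => ?_)
  · obtain ⟨x, hx⟩ := hne
    exact ⟨_, x, hx, (hessian_isSymmetric hf.isOpen_dom
      hf.contDiffOn hx.1.2).hasEigenvalue_iSup_of_finiteDimensional⟩
  · obtain ⟨x, hx, v, hv, rfl⟩ := exists_unit_of_mem_hessianEigenvalues hr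
    exact hmin (a := (x, v)) ⟨hx, mem_sphere_zero_iff_norm.2 hv⟩

lemma minCurv_le_maxCurv [Nontrivial (EuclideanSpace ℝ (Fin n))] (hf : IsGSC D f M ν)
    (hX : IsCompact X) (hne : (levelSet D X f x₀).Nonempty) :
    minCurv f (levelSet D X f x₀) ≤ maxCurv f (levelSet D X f x₀) := by
  obtain ⟨x, hx⟩ := hne
  have h := (hessian_isSymmetric hf.isOpen_dom
    hf.contDiffOn hx.1.2).hasEigenvalue_iSup_of_finiteDimensional
  exact (csInf_le (bddBelow_hessianEigenvalues hf hX) ⟨x, hx, h⟩).trans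
    (le_csSup (bddAbove_hessianEigenvalues hf hX) ⟨x, hx, h⟩)

end LevelSet

/-! ### The constants of the rate -/

section Constants

variable {M ν L d : ℝ}

lemma c1_pos (hν : ν ∈ Set.Icc (2 : ℝ) 3) (hM : 0 < M) (hL : 0 < L) (hd : 0 < d) :
    0 < c1 M ν L d := by
  have hg := gain_pos hν
  unfold gain at hg
  unfold c1
  split_ifs with h h'
  · rw [if_pos h] at hg
    exact lt_min (by norm_num) (by positivity)
  · rw [if_neg h, if_pos h'] at hg
    exact lt_min (by norm_num) (by positivity)
  · rw [if_neg h, if_neg h'] at hg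
    have h2 : 0 < ν / 2 - 1 := by
      have := lt_of_le_of_ne hν.1 (Ne.symm h)
      linarith
    exact lt_min (by norm_num) (by positivity)

lemma c2_pos (hν : ν ∈ Set.Icc (2 : ℝ) 3) (hL : 0 < L) (hd : 0 < d) : 0 < c2 ν L d := by
  have hg := gain_pos hν
  unfold gain at hg
  unfold c2
  split_ifs with h h'
  · rw [if_pos h] at hg
    positivity
  · rw [if_neg h, if_pos h'] at hg
    positivity
  · rw [if_neg h, if_neg h'] at hg
    have h2 := lt_of_le_of_ne hν.1 (Ne.symm h)
    exact mul_pos (div_pos_of_neg_of_neg (by norm_num)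
      (div_neg_of_neg_of_pos (by linarith) (by linarith [hν.2]))) (by positivity)

lemma delta_pos {β e : ℝ} (hν : ν ∈ Set.Icc (2 : ℝ) 3) (hβ : 0 < β) (he : 0 < e) :
    0 < delta ν β e := by
  unfold delta
  split_ifs with h
  · exact hβ
  · have h2 : 0 < ν - 2 := sub_pos.2 (lt_of_le_of_ne hν.1 (Ne.symm h))
    positivity

lemma delta_le {β e : ℝ} (hν : ν ∈ Set.Icc (2 : ℝ) 3) (h2 : ν ≠ 2) (hβ : 0 < β) (hβd : β ≤ d)
    (he : 0 ≤ e) (hL : 0 < L) (heL : e ≤ Real.sqrt L * β) :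
    delta ν β e ≤ (ν / 2 - 1) * (L ^ ((ν - 2) / 2) * d) := by
  have h2' : 0 < ν - 2 := sub_pos.2 (lt_of_le_of_ne hν.1 (Ne.symm h2))
  rw [delta, if_neg h2, mul_assoc, show (ν - 2) / 2 = ν / 2 - 1 by ring]
  refine mul_le_mul_of_nonneg_left ?_ (by linarith)
  calc β ^ (3 - ν) * e ^ (ν - 2) ≤ β ^ (3 - ν) * (Real.sqrt L * β) ^ (ν - 2) :=
        mul_le_mul_of_nonneg_left (Real.rpow_le_rpow he heL h2'.le) (by positivity)
    _ = L ^ (ν / 2 - 1) * β := by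
        rw [Real.mul_rpow (Real.sqrt_nonneg _) hβ.le, Real.sqrt_eq_rpow, ← Real.rpow_mul hL.le,
          mul_left_comm, ← Real.rpow_add hβ, show 3 - ν + (ν - 2) = 1 by ring, Real.rpow_one,
          show 1 / 2 * (ν - 2) = ν / 2 - 1 by ring]
    _ ≤ L ^ (ν / 2 - 1) * d := mul_le_mul_of_nonneg_left hβd (by positivity)

lemma c1_le_gain_div {β e : ℝ} (hν : ν ∈ Set.Icc (2 : ℝ) 3) (hM : 0 < M) (hL : 0 < L)
    (hβ : 0 < β) (hβd : β ≤ d) (he : 0 < e) (heL : e ≤ Real.sqrt L * β) :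
    c1 M ν L d ≤ gain ν / (M * delta ν β e) := by
  have hg := gain_pos hν
  have hδ := delta_pos hν hβ he
  have hd : 0 < d := hβ.trans_le hβd
  by_cases h : ν = 2
  · subst h
    rw [c1, if_pos rfl, gain, if_pos rfl, delta, if_pos rfl]
    rw [gain, if_pos rfl] at hg
    refine (min_le_right _ _).trans ?_
    exact div_le_div_of_nonneg_left hg.le (by positivity) (by gcongr)
  have hle := mul_le_mul_of_nonneg_left (delta_le hν h hβ hβd he.le hL heL) hM.le
  have hmain := div_le_div_of_nonneg_left hg.le (mul_pos hM hδ) hle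
  refine le_trans ?_ hmain
  by_cases h3 : ν = 3
  · subst h3
    rw [c1, if_neg h, if_pos rfl, gain, if_neg h, if_pos rfl]
    refine (min_le_right _ _).trans (le_of_eq ?_)
    rw [Real.sqrt_eq_rpow]
    norm_num
    have : 0 < L ^ (1 / 2 : ℝ) := by positivity
    field_simp
  · rw [c1, if_neg h, if_neg h3, gain, if_neg h, if_neg h3]
    refine (min_le_right _ _).trans (le_of_eq ?_)
    congr 1
    ring

/-- For `ν = 3` the constant `c₂` equals the right-hand side, twice the coefficient of the quadratic
decrease of the model; for `ν < 3` the factor `2` is not needed. -/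
lemma c2_le (hν : ν ∈ Set.Icc (2 : ℝ) 3) (hL : 0 < L) (hd : 0 < d) :
    c2 ν L d ≤ 2 * (gain ν / threshold ν / (L * d ^ 2)) := by
  have hg := gain_pos hν
  have hp := threshold_pos hν
  have hpos : 0 < gain ν / threshold ν / (L * d ^ 2) := by positivity
  unfold c2
  split_ifs with h h'
  · refine le_trans (le_of_eq ?_) (show gain ν / threshold ν / (L * d ^ 2) ≤ _ by linarith)
    rw [gain, threshold, if_pos h, if_pos h, div_one]
  · rw [gain, threshold, if_neg h, if_pos h', if_neg h, h']
    norm_num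
    exact le_of_eq (by ring)
  · refine le_trans (le_of_eq ?_) (show gain ν / threshold ν / (L * d ^ 2) ≤ _ by linarith)
    have h2 := lt_of_le_of_ne hν.1 (Ne.symm h)
    rw [gain, threshold, if_neg h, if_neg h', if_neg h]
    have : 2 - ν ≠ 0 := by linarith
    have : ν - 2 ≠ 0 := by linarith
    have : 4 - ν ≠ 0 := by linarith [hν.2]
    field_simp
    ring

end Constants

/-! ### One step of the method -/

section Step

variable {m n : ℕ} {B : Matrix (Fin m) (Fin n) ℝ} {b : Fin m → ℝ}
  {D : Set (EuclideanSpace ℝ (Fin n))} {f : EuclideanSpace ℝ (Fin n) → ℝ} {M ν : ℝ}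
  {x s u : EuclideanSpace ℝ (Fin n)} {μ : EuclideanSpace ℝ (Fin n) →₀ ℝ}

lemma inner_sub_le_modGap : inner ℝ (gradient f x) (x - s) ≤ modGap f x s u := by
  unfold modGap direction
  split_ifs with h
  · simp [inner_sub_right]
  · simp only [IsForward, inner_sub_right, not_le] at h ⊢
    linarith

lemma inner_sub_le_two_mul_modGap :
    inner ℝ (gradient f x) (u - s) ≤ 2 * modGap f x s u := by
  unfold modGap direction
  split_ifs with h
  · simp only [IsForward, inner_sub_right] at h ⊢
    linarith
  · simp only [IsForward, inner_sub_right, not_le] at h ⊢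
    linarith

lemma IsVertexRep.le_one (h : IsVertexRep B b x μ) (v : EuclideanSpace ℝ (Fin n)) :
    μ v ≤ 1 := by
  by_cases hv : v ∈ μ.support
  · rw [← h.2.2.1]
    exact Finset.single_le_sum (f := fun v => μ v) (fun w _ => h.2.1 w) hv
  · rw [Finsupp.notMem_support_iff.1 hv]
    exact zero_le_one

/-- A point all of whose weight sits on `u` equals `u`, and then the forward step is chosen. -/
lemma IsVertexRep.lt_one_of_not_isForward (h : IsVertexRep B b x μ)
    (hs : ∀ z ∈ polytope B b, inner ℝ (gradient f x) s ≤ inner ℝ (gradient f x) z)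
    (hfw : ¬ IsForward f x s u) : μ u < 1 := by
  refine lt_of_le_of_ne (h.le_one u) fun hu => hfw ?_
  have hsupp : ∀ v ∈ μ.support, v ≠ u → μ v • v = 0 := by
    intro v hv hvu
    have hum : u ∈ μ.support := by
      rw [Finsupp.mem_support_iff, hu]
      exact one_ne_zero
    have h1 := Finset.add_le_sum (f := fun v => μ v) (s := μ.support)
      (fun w _ => h.2.1 w) hv hum hvu
    have h2 : ∑ w ∈ μ.support, μ w = 1 := h.2.2.1
    have h3 : μ v = 0 := le_antisymm (by linarith) (h.2.1 v)
    rw [h3, zero_smul]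
  have hx : x = u := by
    rw [← h.2.2.2, Finsupp.sum, Finset.sum_eq_single u hsupp, hu, one_smul]
    intro hn
    rw [Finsupp.notMem_support_iff.1 hn, zero_smul]
  have := hs x h.mem_polytope
  rw [IsForward, inner_sub_right, ← hx, sub_self, inner_zero_right]
  linarith

lemma IsVertexRep.maxStep_nonneg (h : IsVertexRep B b x μ) : 0 ≤ maxStep f x s u μ := by
  unfold maxStep
  split_ifs
  · exact zero_le_one
  · exact div_nonneg (h.2.1 u) (sub_nonneg.2 (h.le_one u))

lemma card_support_updateWeights_le (hu : u ∈ μ.support) (α : ℝ) :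
    (updateWeights f x s u μ α).support.card ≤ μ.support.card + 1 := by
  classical
  unfold updateWeights
  split_ifs
  · refine (Finset.card_le_card (Finsupp.support_add)).trans ((Finset.card_union_le _ _).trans ?_)
    exact add_le_add (Finset.card_le_card Finsupp.support_smul)
      ((Finset.card_le_card Finsupp.support_single_subset).trans (by simp))
  · refine (Finset.card_le_card (t := μ.support) fun v hv => ?_).trans (Nat.le_succ _)
    by_contra hn
    have hvu : u ≠ v := fun h => hn (h ▸ hu)
    rw [Finsupp.mem_support_iff, Finsupp.sub_apply, Finsupp.smul_apply,
      Finsupp.notMem_support_iff.1 hn, Finsupp.single_eq_of_ne' hvu] at hv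
    simp at hv

/-- An away step of maximal length removes the away vertex from the support. -/
lemma card_support_updateWeights_lt (hu : u ∈ μ.support) (hfw : ¬ IsForward f x s u)
    (hlt : μ u < 1) :
    (updateWeights f x s u μ (maxStep f x s u μ)).support.card < μ.support.card := by
  refine Finset.card_lt_card (Finset.ssubset_iff_of_subset (fun v hv => ?_) |>.2 ⟨u, hu, ?_⟩)
  · by_contra hn
    have hvu : u ≠ v := fun h => hn (h ▸ hu)
    rw [updateWeights, if_neg hfw, Finsupp.mem_support_iff, Finsupp.sub_apply, Finsupp.smul_apply,
      Finsupp.notMem_support_iff.1 hn, Finsupp.single_eq_of_ne' hvu] at hv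
    simp at hv
  · have h1 : 1 - μ u ≠ 0 := by linarith
    rw [updateWeights, if_neg hfw, maxStep, if_neg hfw, Finsupp.notMem_support_iff,
      Finsupp.sub_apply, Finsupp.smul_apply, Finsupp.single_eq_same, smul_eq_mul]
    field_simp
    ring

lemma norm_direction_le_diam (hX : IsCompact (polytope B b)) (hx : x ∈ polytope B b)
    (hs : s ∈ polytope B b) (hu : u ∈ polytope B b) :
    ‖direction f x s u‖ ≤ Metric.diam (polytope B b) := by
  unfold direction
  split_ifs <;> rw [← dist_eq_norm] <;> apply Metric.dist_le_diam_of_mem hX.isBounded <;> assumption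

/-- The decrease of the objective in one step: either the optimality gap shrinks by the factor
`1 - θ` and the support of the weights grows by at most one vertex, or (in an away step of maximal
length) the objective does not increase and the support loses a vertex. -/
lemma step_decrease (hM : 0 < M) (hν : ν ∈ Set.Icc (2 : ℝ) 3) (hf : IsGSC D f M ν)
    (hX : IsCompact (polytope B b)) (hnt : (polytope B b).Nontrivial)
    (hpd : ∀ y ∈ polytope B b ∩ D, ∀ v : EuclideanSpace ℝ (Fin n), v ≠ 0 →
      0 < inner ℝ (hessian f y v) v)
    {xstar x₀ x' : EuclideanSpace ℝ (Fin n)} {μ' : EuclideanSpace ℝ (Fin n) →₀ ℝ} {α : ℝ}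
    (hstar : xstar ∈ solutionSet D (polytope B b) f)
    (hxD : x ∈ D) (hx₀ : f x ≤ f x₀) (hμ : IsVertexRep B b x μ)
    (hsV : s ∈ vertices B b)
    (hs : ∀ z ∈ polytope B b, inner ℝ (gradient f x) s ≤ inner ℝ (gradient f x) z)
    (hu : u ∈ μ.support)
    (humax : ∀ w ∈ μ.support, inner ℝ (gradient f x) w ≤ inner ℝ (gradient f x) u)
    (hα : IsStepSize M ν (modGap f x s u) ‖direction f x s u‖
      (localNorm f x (direction f x s u)) (maxStep f x s u μ) α)
    (hx' : x' = x + α • direction f x s u) (hx'X : x' ∈ polytope B b)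
    (hμ' : μ'.support ⊆ (updateWeights f x s u μ α).support) :
    x' ∈ D ∧
      ((f x' - f xstar ≤ (1 - theta B b D f M ν x₀) * (f x - f xstar) ∧
          μ'.support.card ≤ μ.support.card + 1) ∨
        (f x' ≤ f x ∧ μ'.support.card + 1 ≤ μ.support.card)) := by
  have hxX := hμ.mem_polytope
  have huX : u ∈ polytope B b := (hμ.1 u hu).1
  have hcard : μ'.support.card ≤ μ.support.card + 1 :=
    (Finset.card_le_card hμ').trans (card_support_updateWeights_le hu α)
  have hxS : x ∈ levelSet D (polytope B b) f x₀ := ⟨⟨hxX, hxD⟩, hx₀⟩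
  have hstarS : xstar ∈ levelSet D (polytope B b) f x₀ :=
    ⟨hstar.1, (hstar.2 x ⟨hxX, hxD⟩).trans hx₀⟩
  obtain ⟨p, hp, p', hp', hpp'⟩ := id hnt
  have hE : Nontrivial (EuclideanSpace ℝ (Fin n)) := ⟨p, p', hpp'⟩
  have hd : 0 < Metric.diam (polytope B b) :=
    (dist_pos.2 hpp').trans_le (Metric.dist_le_diam_of_mem hX.isBounded hp hp')
  have hdir := norm_direction_le_diam (f := f) hX hxX hsV.1 huX
  have hΩ := Omega_pos hX hnt
  have hσ : 0 < minCurv f (levelSet D (polytope B b) f x₀) := minCurv_pos hf hX hpd ⟨x, hxS⟩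
  have hL := hσ.trans_le (minCurv_le_maxCurv hf hX ⟨x, hxS⟩)
  have hθ1 : theta B b D f M ν x₀ ≤ 1 / 2 := min_le_left _ _
  have hθ2 : theta B b D f M ν x₀ ≤
      c1 M ν (maxCurv f (levelSet D (polytope B b) f x₀)) (Metric.diam (polytope B b)) *
        Omega B b / (2 * Metric.diam (polytope B b)) := (min_le_right _ _).trans (min_le_left _ _)
  have hθ3 : theta B b D f M ν x₀ ≤
      c2 ν (maxCurv f (levelSet D (polytope B b) f x₀)) (Metric.diam (polytope B b)) *
        Omega B b ^ 2 * minCurv f (levelSet D (polytope B b) f x₀) / 8 :=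
    (min_le_right _ _).trans (min_le_right _ _)
  have hc1 := c1_pos (M := M) hν hM hL hd
  have hc2 := c2_pos hν hL hd
  -- strong convexity on the segment from `x` to the minimizer
  have hsc : f x - f xstar + minCurv f (levelSet D (polytope B b) f x₀) / 2 * ‖x - xstar‖ ^ 2 ≤
      inner ℝ (gradient f x) (x - xstar) := by
    have hseg : ∀ t ∈ Set.Icc (0 : ℝ) 1,
        x + t • (xstar - x) ∈ levelSet D (polytope B b) f x₀ := fun t ht =>
      (convex_levelSet hf convex_polytope).add_smul_sub_mem hxS hstarS ht
    have h := quadratic_lower_bound hf.isOpen_dom hf.contDiffOn (fun t ht => (hseg t ht).1.2)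
      (fun t ht => minCurv_le_inner_hessian hf hX (hseg t ht) (xstar - x))
    rw [add_sub_cancel, norm_sub_rev, inner_sub_right] at h
    rw [inner_sub_right]
    linarith
  have hpyr := Omega_mul_inner_le hX hnt hμ hstar.1.1 hs hu humax
  have hgap2 := inner_sub_le_two_mul_modGap (f := f) (x := x) (s := s) (u := u)
  have hrd : ‖x - xstar‖ ≤ Metric.diam (polytope B b) := by
    rw [← dist_eq_norm]
    exact Metric.dist_le_diam_of_mem hX.isBounded hxX hstar.1.1
  have hh0 : 0 ≤ f x - f xstar := sub_nonneg.2 (hstar.2 x ⟨hxX, hxD⟩)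
  have hsr : 0 ≤ minCurv f (levelSet D (polytope B b) f x₀) / 2 * ‖x - xstar‖ ^ 2 := by positivity
  have hGh : f x - f xstar ≤ modGap f x s u := by
    have h1 := inner_sub_le_modGap (f := f) (x := x) (s := s) (u := u)
    have h2 := hs xstar hstar.1.1
    rw [inner_sub_right] at h1 hsc
    linarith
  have hG0 : 0 ≤ modGap f x s u := hh0.trans hGh
  have htbar := hμ.maxStep_nonneg (f := f) (s := s) (u := u)
  by_cases hv : direction f x s u = 0
  · -- the direction vanishes only at a minimizer
    rw [hv, smul_zero, add_zero] at hx'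
    have hG : modGap f x s u = 0 := by rw [modGap, hv, inner_zero_right, neg_zero]
    have h0 : f x - f xstar = 0 := le_antisymm (hG ▸ hGh) hh0
    rw [hx']
    exact ⟨hxD, Or.inl ⟨by rw [h0, mul_zero], hcard⟩⟩
  have hβ : 0 < ‖direction f x s u‖ := norm_pos_iff.2 hv
  have hq : 0 < inner ℝ (hessian f x (direction f x s u)) (direction f x s u) :=
    hpd x ⟨hxX, hxD⟩ _ hv
  have he : 0 < localNorm f x (direction f x s u) := Real.sqrt_pos.2 hq
  have ha : 0 < M * delta ν ‖direction f x s u‖ (localNorm f x (direction f x s u)) :=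
    mul_pos hM (delta_pos hν hβ he)
  obtain ⟨hαI, hdom, hmin⟩ := hα.isMin hν ha he hG0 htbar
  have hseg : ∀ t ∈ Set.Icc 0 α, x + t • direction f x s u ∈ polytope B b := by
    intro t ht
    rcases ht.1.eq_or_lt with h0 | h0
    · simpa [← h0] using hxX
    · have hα0 : 0 < α := h0.trans_le ht.2
      have h1 := convex_polytope.add_smul_sub_mem hxX hx'X (t := t / α)
        ⟨div_nonneg ht.1 hα0.le, (div_le_one hα0).2 ht.2⟩
      rwa [hx', add_sub_cancel_left, smul_smul, div_mul_cancel₀ _ hα0.ne'] at h1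
  obtain ⟨hD', hle⟩ := mem_and_le_upperModel hν hf hαI.1 hxD ha he
    (fun t ht htD => hpd _ ⟨hseg t ht, htD⟩ _ hv) hdom
  rw [← hx'] at hD' hle
  change f x' ≤ f x + upperModel M ν (modGap f x s u) _ _ α at hle
  refine ⟨hD', ?_⟩
  -- it suffices to decrease the model by `θ` times the optimality gap
  have hgood : upperModel M ν (modGap f x s u) ‖direction f x s u‖
        (localNorm f x (direction f x s u)) α ≤
        -(theta B b D f M ν x₀ * (f x - f xstar)) →
      f x' - f xstar ≤ (1 - theta B b D f M ν x₀) * (f x - f xstar) := fun h => by linarith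
  rcases hαI.2.lt_or_eq with hlt | heq
  · refine Or.inl ⟨hgood ?_, hcard⟩
    have heL : localNorm f x (direction f x s u) ≤
        Real.sqrt (maxCurv f (levelSet D (polytope B b) f x₀)) * ‖direction f x s u‖ := by
      rw [localNorm, ← Real.sqrt_sq (norm_nonneg (direction f x s u)), ← Real.sqrt_mul hL.le]
      exact Real.sqrt_le_sqrt (inner_hessian_le_maxCurv hf hX hxS _)
    rcases upperModel_le_of_lt hν ha he hG0 ⟨hαI.1, hlt⟩ hdom hmin with h | h
    · refine h.trans (neg_le_neg ?_)
      have h1 := c1_le_gain_div hν hM hL hβ hdir he heL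
      have h2 : Omega B b * (f x - f xstar) ≤
          2 * Metric.diam (polytope B b) * modGap f x s u := by
        calc Omega B b * (f x - f xstar) ≤ Omega B b * inner ℝ (gradient f x) (x - xstar) :=
              mul_le_mul_of_nonneg_left (by linarith) hΩ.le
          _ ≤ ‖x - xstar‖ * (2 * modGap f x s u) :=
              hpyr.trans (mul_le_mul_of_nonneg_left hgap2 (norm_nonneg _))
          _ ≤ Metric.diam (polytope B b) * (2 * modGap f x s u) :=
              mul_le_mul_of_nonneg_right hrd (by positivity)
          _ = _ := by ring
      have h3 : Omega B b * (f x - f xstar) / (2 * Metric.diam (polytope B b)) ≤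
          modGap f x s u := by
        rw [div_le_iff₀ (by positivity)]
        linarith
      refine (mul_le_mul_of_nonneg_right hθ2 hh0).trans ?_
      calc _ = c1 M ν (maxCurv f (levelSet D (polytope B b) f x₀)) (Metric.diam (polytope B b)) *
            (Omega B b * (f x - f xstar) / (2 * Metric.diam (polytope B b))) := by ring
        _ ≤ c1 M ν (maxCurv f (levelSet D (polytope B b) f x₀)) (Metric.diam (polytope B b)) *
            modGap f x s u := mul_le_mul_of_nonneg_left h3 hc1.le
        _ ≤ _ := mul_le_mul_of_nonneg_right h1 hG0
        _ = _ := by ring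
    · refine h.trans (neg_le_neg ?_)
      have h1 := c2_le hν hL hd
      have he2 : localNorm f x (direction f x s u) ^ 2 ≤
          maxCurv f (levelSet D (polytope B b) f x₀) * Metric.diam (polytope B b) ^ 2 := by
        rw [localNorm_sq_of_pos hq]
        refine (inner_hessian_le_maxCurv hf hX hxS _).trans
          (mul_le_mul_of_nonneg_left ?_ hL.le)
        exact pow_le_pow_left₀ (norm_nonneg _) hdir 2
      -- `Ω (h + σ r² / 2) ≤ 2 r G`, and the arithmetic-geometric mean inequality removes `r`
      have hG2 : Omega B b ^ 2 * minCurv f (levelSet D (polytope B b) f x₀) * (f x - f xstar) ≤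
          2 * modGap f x s u ^ 2 := by
        generalize minCurv f (levelSet D (polytope B b) f x₀) = σ at *
        generalize modGap f x s u = G at *
        have hA : Omega B b * (f x - f xstar + σ / 2 * ‖x - xstar‖ ^ 2) ≤
            2 * ‖x - xstar‖ * G :=
          calc _ ≤ Omega B b * inner ℝ (gradient f x) (x - xstar) :=
              mul_le_mul_of_nonneg_left hsc hΩ.le
            _ ≤ ‖x - xstar‖ * (2 * G) :=
              hpyr.trans (mul_le_mul_of_nonneg_left hgap2 (norm_nonneg _))
            _ = _ := by ring
        rcases (norm_nonneg (x - xstar)).eq_or_lt with hr | hr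
        · have : x = xstar := by rwa [eq_comm, norm_eq_zero, sub_eq_zero] at hr
          rw [this, sub_self, mul_zero]
          positivity
        · generalize f x - f xstar = h at *
          generalize ‖x - xstar‖ = r at *
          have h3 := pow_le_pow_left₀ (by positivity) hA 2
          have h4 : 2 * h * σ * r ^ 2 ≤ (h + σ / 2 * r ^ 2) ^ 2 := by
            nlinarith [sq_nonneg (h - σ / 2 * r ^ 2)]
          have h5 := mul_le_mul_of_nonneg_left h4 (sq_nonneg (Omega B b))
          have h6 : (Omega B b ^ 2 * σ * h) * (2 * r ^ 2) ≤ (2 * G ^ 2) * (2 * r ^ 2) := by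
            calc _ = Omega B b ^ 2 * (2 * h * σ * r ^ 2) := by ring
              _ ≤ Omega B b ^ 2 * (h + σ / 2 * r ^ 2) ^ 2 := h5
              _ = (Omega B b * (h + σ / 2 * r ^ 2)) ^ 2 := by ring
              _ ≤ (2 * r * G) ^ 2 := h3
              _ = _ := by ring
          exact le_of_mul_le_mul_right h6 (by positivity)
      have hκ : 0 < gain ν / threshold ν := div_pos (gain_pos hν) (threshold_pos hν)
      refine (mul_le_mul_of_nonneg_right hθ3 hh0).trans ?_
      calc _ = c2 ν (maxCurv f (levelSet D (polytope B b) f x₀)) (Metric.diam (polytope B b)) *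
            (Omega B b ^ 2 * minCurv f (levelSet D (polytope B b) f x₀) * (f x - f xstar)) / 8 := by
              ring
        _ ≤ c2 ν (maxCurv f (levelSet D (polytope B b) f x₀)) (Metric.diam (polytope B b)) *
            (2 * modGap f x s u ^ 2) / 8 := by gcongr
        _ ≤ 2 * (gain ν / threshold ν / (maxCurv f (levelSet D (polytope B b) f x₀) *
            Metric.diam (polytope B b) ^ 2)) * (2 * modGap f x s u ^ 2) / 8 := by gcongr
        _ ≤ gain ν / threshold ν / (maxCurv f (levelSet D (polytope B b) f x₀) *
            Metric.diam (polytope B b) ^ 2) * modGap f x s u ^ 2 := by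
              have : 0 ≤ gain ν / threshold ν / (maxCurv f (levelSet D (polytope B b) f x₀) *
                Metric.diam (polytope B b) ^ 2) * modGap f x s u ^ 2 := by positivity
              linarith
        _ ≤ gain ν / threshold ν / localNorm f x (direction f x s u) ^ 2 *
            modGap f x s u ^ 2 := by gcongr
        _ = _ := by ring
  · by_cases hfw : IsForward f x s u
    · have h1 : maxStep f x s u μ = 1 := if_pos hfw
      rw [h1] at heq hmin
      subst heq
      refine Or.inl ⟨hgood ((upperModel_one_le hν ha he hdom hmin).trans ?_), hcard⟩
      have := mul_le_mul_of_nonneg_right hθ1 hh0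
      linarith
    · have hlt := hμ.lt_one_of_not_isForward hs hfw
      refine Or.inr ⟨?_, ?_⟩
      · have h0 := hmin 0 ⟨le_rfl, htbar⟩ (hdom.mono (by
          rw [zero_mul]; exact mul_nonneg hαI.1 ha.le))
        have h1 : upperModel M ν (modGap f x s u) ‖direction f x s u‖
            (localNorm f x (direction f x s u)) 0 = 0 := by simp [upperModel]
        linarith
      · rw [heq] at hμ'
        exact (Finset.card_le_card hμ').trans_lt (card_support_updateWeights_lt hu hfw hlt)

end Step

/-! ### Linear convergence -/

section Rate

variable {m n : ℕ} {B : Matrix (Fin m) (Fin n) ℝ} {b : Fin m → ℝ}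
  {D : Set (EuclideanSpace ℝ (Fin n))} {f : EuclideanSpace ℝ (Fin n) → ℝ} {M ν : ℝ}

lemma theta_le_half (x₀ : EuclideanSpace ℝ (Fin n)) : theta B b D f M ν x₀ ≤ 1 / 2 :=
  min_le_left _ _

lemma theta_pos (hM : 0 < M) (hν : ν ∈ Set.Icc (2 : ℝ) 3) (hf : IsGSC D f M ν)
    (hX : IsCompact (polytope B b)) (hnt : (polytope B b).Nontrivial)
    (hpd : ∀ y ∈ polytope B b ∩ D, ∀ v : EuclideanSpace ℝ (Fin n), v ≠ 0 →
      0 < inner ℝ (hessian f y v) v)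
    {x₀ : EuclideanSpace ℝ (Fin n)} (hx₀ : x₀ ∈ polytope B b ∩ D) :
    0 < theta B b D f M ν x₀ := by
  obtain ⟨p, hp, p', hp', hpp'⟩ := id hnt
  have hE : Nontrivial (EuclideanSpace ℝ (Fin n)) := ⟨p, p', hpp'⟩
  have hd : 0 < Metric.diam (polytope B b) :=
    (dist_pos.2 hpp').trans_le (Metric.dist_le_diam_of_mem hX.isBounded hp hp')
  have hne : (levelSet D (polytope B b) f x₀).Nonempty := ⟨x₀, hx₀, le_rfl⟩
  have hσ := minCurv_pos hf hX hpd hne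
  have hL := hσ.trans_le (minCurv_le_maxCurv hf hX hne)
  have hΩ := Omega_pos hX hnt
  have hc1 := c1_pos (M := M) hν hM hL hd
  have hc2 := c2_pos hν hL hd
  exact lt_min (by norm_num) (lt_min (by positivity) (by positivity))

variable {xstar : EuclideanSpace ℝ (Fin n)} {x s u : ℕ → EuclideanSpace ℝ (Fin n)}
  {μ : ℕ → EuclideanSpace ℝ (Fin n) →₀ ℝ} {α : ℕ → ℝ}

lemma IsRun.isVertexRep (hrun : IsRun B b D f M ν x s u μ α) (k : ℕ) :
    IsVertexRep B b (x k) (μ k) := by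
  cases k with
  | succ k => exact hrun.weights_rep k
  | zero =>
    rw [hrun.init_weights]
    refine ⟨fun v hv => ?_, fun v => ?_, by simp, by simp⟩
    · have := Finsupp.support_single_subset hv
      rw [Finset.mem_singleton] at this
      exact this ▸ hrun.init_mem.2
    · exact Finsupp.single_nonneg.2 zero_le_one v

/-- Among the first `k` steps there are `g` steps that shrink the gap by `1 - θ`. Each of them adds
at most one vertex to the support, each other step removes one, and the support, which starts with
one vertex, never becomes empty; so `g ≥ k / 2`. -/
lemma IsRun.exists_good_steps (hM : 0 < M) (hν : ν ∈ Set.Icc (2 : ℝ) 3) (hf : IsGSC D f M ν)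
    (hX : IsCompact (polytope B b)) (hnt : (polytope B b).Nontrivial)
    (hpd : ∀ y ∈ polytope B b ∩ D, ∀ v : EuclideanSpace ℝ (Fin n), v ≠ 0 →
      0 < inner ℝ (hessian f y v) v)
    (hstar : xstar ∈ solutionSet D (polytope B b) f)
    (hrun : IsRun B b D f M ν x s u μ α) (k : ℕ) :
    x k ∈ D ∧ ∃ g : ℕ, k + (μ k).support.card ≤ 1 + 2 * g ∧
      f (x k) - f xstar ≤ (1 - theta B b D f M ν (x 0)) ^ g * (f (x 0) - f xstar) := by
  have hX0 := (hrun.isVertexRep 0).mem_polytope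
  have hθ0 := theta_pos hM hν hf hX hnt hpd ⟨hX0, hrun.init_mem.1⟩
  have hθ1 := theta_le_half (B := B) (b := b) (D := D) (f := f) (M := M) (ν := ν) (x 0)
  have hh0 : 0 ≤ f (x 0) - f xstar := sub_nonneg.2 (hstar.2 _ ⟨hX0, hrun.init_mem.1⟩)
  induction k with
  | zero =>
    refine ⟨hrun.init_mem.1, 0, ?_, by simp⟩
    rw [hrun.init_weights]
    have := Finset.card_le_card (Finsupp.support_single_subset (a := x 0) (b := (1 : ℝ)))
    rw [Finset.card_singleton] at this
    omega
  | succ k ih =>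
    obtain ⟨hD, g, hg, hle⟩ := ih
    have hpow : (1 - theta B b D f M ν (x 0)) ^ g ≤ 1 :=
      pow_le_one₀ (by linarith) (by linarith)
    have hdec : f (x k) ≤ f (x 0) := by
      have := hle.trans (mul_le_of_le_one_left hh0 hpow)
      linarith
    obtain ⟨hD', h⟩ := step_decrease hM hν hf hX hnt hpd hstar hD hdec (hrun.isVertexRep k)
      (hrun.oracle_vertex k) (hrun.oracle_min k) (hrun.away_mem k) (hrun.away_max k)
      (hrun.step k) (hrun.next k) (hrun.isVertexRep (k + 1)).mem_polytope (hrun.weights_support k)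
    refine ⟨hD', ?_⟩
    rcases h with ⟨h, hc⟩ | ⟨h, hc⟩
    · refine ⟨g + 1, by omega, h.trans ?_⟩
      rw [pow_succ', mul_assoc]
      exact mul_le_mul_of_nonneg_left hle (by linarith)
    · exact ⟨g, by omega, by linarith⟩

end Rate

end

end ASFW

theorem mainTheorem2 {m n : ℕ} (B : Matrix (Fin m) (Fin n) ℝ) (b : Fin m → ℝ)
    (D : Set (EuclideanSpace ℝ (Fin n))) (f : EuclideanSpace ℝ (Fin n) → ℝ) (M ν : ℝ)
    (hM : 0 < M) (hν : ν ∈ Set.Icc (2 : ℝ) 3)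
    (hf : ASFW.IsGSC D f M ν)
    (hX : IsCompact (ASFW.polytope B b))
    (hpd : ∀ y ∈ ASFW.polytope B b ∩ D, ∀ v : EuclideanSpace ℝ (Fin n), v ≠ 0 →
      0 < inner ℝ (ASFW.hessian f y v) v)
    (xstar : EuclideanSpace ℝ (Fin n))
    (hstar : xstar ∈ ASFW.solutionSet D (ASFW.polytope B b) f)
    (x s u : ℕ → EuclideanSpace ℝ (Fin n)) (μ : ℕ → EuclideanSpace ℝ (Fin n) →₀ ℝ)
    (α : ℕ → ℝ) (hrun : ASFW.IsRun B b D f M ν x s u μ α) :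
    ((ASFW.polytope B b).Nontrivial → 0 < ASFW.theta B b D f M ν (x 0)) ∧
    ∀ k : ℕ, x k ∈ ASFW.polytope B b ∩ D ∧
      f (x k) - f xstar ≤
        (1 - ASFW.theta B b D f M ν (x 0)) ^ ((k : ℝ) / 2) * (f (x 0) - f xstar) ∧
      (1 - ASFW.theta B b D f M ν (x 0)) ^ ((k : ℝ) / 2) * (f (x 0) - f xstar) ≤
        Real.exp (-(ASFW.theta B b D f M ν (x 0) * ((k : ℝ) / 2))) * (f (x 0) - f xstar) := by
  refine ⟨fun hnt => ASFW.theta_pos hM hν hf hX hnt hpd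
    ⟨(hrun.isVertexRep 0).mem_polytope, hrun.init_mem.1⟩, fun k => ?_⟩
  have hθ1 := ASFW.theta_le_half (B := B) (b := b) (D := D) (f := f) (M := M) (ν := ν) (x 0)
  have hh0 : 0 ≤ f (x 0) - f xstar :=
    sub_nonneg.2 (hstar.2 _ ⟨(hrun.isVertexRep 0).mem_polytope, hrun.init_mem.1⟩)
  have hexp : (1 - ASFW.theta B b D f M ν (x 0)) ^ ((k : ℝ) / 2) ≤
      Real.exp (-(ASFW.theta B b D f M ν (x 0) * ((k : ℝ) / 2))) := by
    rw [← neg_mul, Real.exp_mul]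
    exact Real.rpow_le_rpow (by linarith) (Real.one_sub_le_exp_neg _) (by positivity)
  have hxX := (hrun.isVertexRep k).mem_polytope
  by_cases hnt : (ASFW.polytope B b).Nontrivial
  · obtain ⟨hD, g, hg, hle⟩ := hrun.exists_good_steps hM hν hf hX hnt hpd hstar k
    have hθ0 := ASFW.theta_pos hM hν hf hX hnt hpd
      ⟨(hrun.isVertexRep 0).mem_polytope, hrun.init_mem.1⟩
    have hcard : 0 < (μ k).support.card := Finset.card_pos.2 ⟨u k, hrun.away_mem k⟩
    have hk : (k : ℝ) / 2 ≤ g := by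
      have : (k : ℝ) ≤ 2 * g := by exact_mod_cast (by omega : k ≤ 2 * g)
      linarith
    refine ⟨⟨hxX, hD⟩, hle.trans (mul_le_mul_of_nonneg_right ?_ hh0),
      mul_le_mul_of_nonneg_right hexp hh0⟩
    rw [← Real.rpow_natCast]
    exact Real.rpow_le_rpow_of_exponent_ge (by linarith) (by linarith) hk
  · -- in a one-point polytope every iterate is the minimizer
    rw [Set.not_nontrivial_iff] at hnt
    have hk : x k = xstar := hnt hxX hstar.1.1
    have h0 : x 0 = xstar := hnt (hrun.isVertexRep 0).mem_polytope hstar.1.1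
    rw [hk, h0]
    simp [hstar.1.1, hstar.1.2]
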